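/- **Setting.** Let $\tau_n=(n_1,\dots,n_t)$ be a partition of $n$ into $t\ge 2$ positive integers. Partition $n\times n$ real matrices $X$ accordingly into blocks $X_{jk}\in\mathbb R^{n_j\times n_k}$; let $\mathbb D_{\tau_n}$ be the set of block diagonal matrices ($X_{jk}=0$ for $j\neq k$), and $\mathbb P_{\tau_n}$ the set of permutation matrices $\Pi$ with $\Pi^{\rm T}D\Pi\in\mathbb D_{\tau_n}$ for all $D\in\mathbb D_{\tau_n}$. Let $\mathcal A=\{A_i\}_{i=1}^m$, $\widetilde{\mathcal A}=\{\widetilde A_i\}_{i=1}^m\subset\mathbb R^{n\times n}$ and let $W,\widetilde W\in\mathbb R^{n\times n}$ be orthogonal. Assume that all $W^{\rm T}A_iW=\operatorname{diag}(A_i^{(11)},\dots,A_i^{(tt)})$ are block diagonal and that, for every $j$, the space of all $Z\in\mathbb R^{n_j\times n_j}$ with $A_i^{(jj)}Z-Z^{\rm T}A_i^{(jj)}=0$ for $i=1,\dots,m$ has dimension $1$. Let $\gamma_1,\dots,\gamma_t$ be distinct real numbers with $|\gamma_j|\le1$, $\Gamma=\operatorname{diag}(\gamma_1I_{n_1},\dots,\gamma_tI_{n_t})$,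 $g=\min_{j\ne k}|\gamma_j-\gamma_k|$, and $$\widetilde R_i=\widetilde W^{\rm T}\widetilde A_i\widetilde W\Gamma-\Gamma\widetilde W^{\rm T}\widetilde A_i\widetilde W,\quad \tilde r=\Big(\sum_{i=1}^m\|\widetilde R_i\|_F^2\Big)^{1/2},\quad \delta_{\mathcal A}=\Big(\sum_{i=1}^m\|\widetilde A_i-A_i\|_F^2\Big)^{1/2}.$$ For $j<k$ let $G_{jk}$ be the matrix obtained by stacking, for $i=1,\dots,m$, the block rows $\big[I_{n_k}\otimes A_i^{(jj)},\ (A_i^{(kk)})^{\rm T}\otimes I_{n_j}\big]$ and $\big[I_{n_k}\otimes (A_i^{(jj)})^{\rm T},\ A_i^{(kk)}\otimes I_{n_j}\big]$, and let $G_{jj}$ be obtained by stacking the matrices $I_{n_j}\otimes A_i^{(jj)}-\big((A_i^{(jj)})^{\rm T}\otimes I_{n_j}\big)\Pi_j$, where $\Pi_j$ is the perfect shuffle ($\Pi_j\operatorname{vec}(Z^{\rm T})=\operatorname{vec}(Z)$). Let $\omega_{\rm uq}=\min_{j<k}\sigma_{\min}(G_{jk})$ (a matrix has as many singular values as columns),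 and let $\omega_{\rm nd}$ be the minimum over all $j$ with $n_j>1$ of the smallest nonzero singular value of $G_{jj}$, with $\omega_{\rm nd}=\infty$ if all $n_j=1$. Put $Q=W^{-1}\widetilde W$, $\kappa_2(Q)=\|Q\|_2\|Q^{-1}\|_2$, $$\tau=\frac{\sqrt2-1}{\sqrt{t-1}},\qquad \alpha=\frac{2\tau}{(\sqrt2+\tau)^2},\qquad \delta=\|Q^{-1}\|_2^2\,\tilde r+2\|Q^{-1}\|_2\|W\|_2\|\widetilde W\|_2\,\delta_{\mathcal A}.$$ **Claim.** Then $\delta=\tilde r+2\delta_{\mathcal A}$. If moreover $$\delta<\min\Big\{\frac{\alpha g\,\omega_{\rm uq}}{\kappa_2(Q)},\ \frac{(1-2\alpha)g\,\omega_{\rm nd}}{\sqrt2}\Big\},$$ then for $p\in\{2,F\}$ (spectral and Frobenius norm) the following minimum is attained and satisfies $$\min_{\substack{D\in\mathbb D_{\tau_n},\,D^{\rm T}D=I\\ \Pi\in\mathbb P_{\tau_n}}}\frac{\|W-\widetilde WD\Pi\|_p}{\|\widetilde W\|_p}\ \le\ \frac{\tau}{\alpha}\cdot\frac{(\sqrt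 t+\sqrt{t-1})\,\delta}{g\,\omega_{\rm uq}}+O(\delta^2),$$ where $O(\delta^2)$ stands for $C_t\,\big(\delta/(g\,\omega_{\rm uq})\big)^2$ with a constant $C_t$ that depends only on $t$. -/

import Mathlib

open scoped Matrix Kronecker

noncomputable section

namespace JBD

/-! ### Norms and singular values -/

/-- The spectral norm of a square real matrix: its operator norm for the Euclidean norm. -/
def specNorm {n : ℕ} (A : Matrix (Fin n) (Fin n) ℝ) : ℝ :=
  ‖Matrix.toEuclideanCLM (n := Fin n) (𝕜 := ℝ) A‖

/-- The Frobenius norm of a square real matrix. -/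
def frobNorm {n : ℕ} (A : Matrix (Fin n) (Fin n) ℝ) : ℝ :=
  √(∑ i, ∑ j, A i j ^ 2)

/-- The Frobenius norm `(∑ᵢ ‖Aᵢ‖_F²)^{1/2}` of a finite family of square matrices. -/
def famNorm {m n : ℕ} (A : Fin m → Matrix (Fin n) (Fin n) ℝ) : ℝ :=
  √(∑ i, frobNorm (A i) ^ 2)

/-- The spectral condition number `κ₂(Q) = ‖Q‖₂ ‖Q⁻¹‖₂`. -/
def cond₂ {n : ℕ} (Q : Matrix (Fin n) (Fin n) ℝ) : ℝ :=
  specNorm Q * specNorm Q⁻¹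

/-- The smallest singular value of a matrix. A matrix has as many singular values as it has
columns; Mathlib lists them in decreasing order, starting from the index `0`. -/
def sigmaMin {R K : Type*} [Fintype R] [DecidableEq R] [Fintype K] [DecidableEq K]
    (G : Matrix R K ℝ) : ℝ :=
  (Matrix.toEuclideanLin G).singularValues (Fintype.card K - 1)

/-- The smallest nonzero singular value of a (nonzero) matrix. -/
def sigmaMinNonzero {R K : Type*} [Fintype R] [DecidableEq R] [Fintype K] [DecidableEq K]
    (G : Matrix R K ℝ) : ℝ :=
  sInf {s : ℝ | s ≠ 0 ∧ ∃ i : ℕ, s = (Matrix.toEuclideanLin G).singularValues i}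

/-! ### Partitions and block diagonal matrices

A partition `τ = (n₁, …, n_t)` of `n` (positive integers in a fixed order with sum `n`) is
`c : Composition n`; its cardinality `t` is `c.length`, and `n_j` is `c.blocksFun j`. -/

/-- The block `A_{jk}`, of size `n_j × n_k`, of a matrix partitioned according to `c`. -/
def block {n : ℕ} (c : Composition n) (A : Matrix (Fin n) (Fin n) ℝ) (j k : Fin c.length) :
    Matrix (Fin (c.blocksFun j)) (Fin (c.blocksFun k)) ℝ :=
  A.submatrix (c.embedding j) (c.embedding k)

/-- `A` is block diagonal with respect to `c`: all blocks off the diagonal vanish. -/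
def IsBlockDiag {n : ℕ} (c : Composition n) (A : Matrix (Fin n) (Fin n) ℝ) : Prop :=
  ∀ j k : Fin c.length, j ≠ k → block c A j k = 0

/-- `P` is a permutation matrix that preserves block diagonality: `Pᵀ D P` is block diagonal
for every block diagonal `D`. -/
def IsBlockPreservingPerm {n : ℕ} (c : Composition n) (P : Matrix (Fin n) (Fin n) ℝ) : Prop :=
  (∃ σ : Equiv.Perm (Fin n), P = σ.permMatrix ℝ) ∧
    ∀ D : Matrix (Fin n) (Fin n) ℝ, IsBlockDiag c D → IsBlockDiag c (Pᵀ * D * P)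

/-- `W` is a block diagonalizer of the family `A`. -/
def IsBlockDiagonalizer {m n : ℕ} (c : Composition n) (A : Fin m → Matrix (Fin n) (Fin n) ℝ)
    (W : Matrix (Fin n) (Fin n) ℝ) : Prop :=
  IsUnit W ∧ ∀ i, IsBlockDiag c (Wᵀ * A i * W)

/-- The family `𝒜_j = {A_i^{(jj)}}_i` of the `j`-th diagonal blocks of the `Wᵀ A_i W`. -/
def diagBlocks {m n : ℕ} (c : Composition n) (A : Fin m → Matrix (Fin n) (Fin n) ℝ)
    (W : Matrix (Fin n) (Fin n) ℝ) (j : Fin c.length) :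
    Fin m → Matrix (Fin (c.blocksFun j)) (Fin (c.blocksFun j)) ℝ :=
  fun i => block c (Wᵀ * A i * W) j j

/-- The space `𝒩(𝒜)` of all `Z` with `A_i Z - Zᵀ A_i = 0` for every `i`. -/
def nullSpace {m d : ℕ} (A : Fin m → Matrix (Fin d) (Fin d) ℝ) :
    Submodule ℝ (Matrix (Fin d) (Fin d) ℝ) where
  carrier := {Z | ∀ i, A i * Z - Zᵀ * A i = 0}
  add_mem' := by
    intro X Y hX hY i
    have h : A i * (X + Y) - (X + Y)ᵀ * A i
        = (A i * X - Xᵀ * A i) + (A i * Y - Yᵀ * A i) := by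
      rw [Matrix.transpose_add, Matrix.mul_add, Matrix.add_mul]
      abel
    rw [h, hX i, hY i, add_zero]
  zero_mem' := by
    intro i
    simp
  smul_mem' := by
    intro r X hX i
    have h : A i * (r • X) - (r • X)ᵀ * A i = r • (A i * X - Xᵀ * A i) := by
      rw [Matrix.transpose_smul, Matrix.mul_smul, Matrix.smul_mul, smul_sub]
    rw [h, hX i, smul_zero]

/-! ### The moduli of uniqueness and of non-divisibility -/

/-- The matrix `G_{jk}` for the families `A = 𝒜_j` (order `p = n_j`) and `B = 𝒜_k`
(order `q = n_k`): for `i = 1, …, m` the block rows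
`[I_q ⊗ A_i, B_iᵀ ⊗ I_p]` and `[I_q ⊗ A_iᵀ, B_i ⊗ I_p]` are stacked. -/
def offG {m p q : ℕ} (A : Fin m → Matrix (Fin p) (Fin p) ℝ)
    (B : Fin m → Matrix (Fin q) (Fin q) ℝ) :
    Matrix (Fin m × ((Fin q × Fin p) ⊕ (Fin q × Fin p)))
      ((Fin q × Fin p) ⊕ (Fin q × Fin p)) ℝ :=
  Matrix.of fun r s =>
    Matrix.fromBlocks
      ((1 : Matrix (Fin q) (Fin q) ℝ) ⊗ₖ A r.1) ((B r.1)ᵀ ⊗ₖ (1 : Matrix (Fin p) (Fin p) ℝ))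
      ((1 : Matrix (Fin q) (Fin q) ℝ) ⊗ₖ (A r.1)ᵀ) (B r.1 ⊗ₖ (1 : Matrix (Fin p) (Fin p) ℝ))
      r.2 s

/-- The perfect shuffle: the permutation matrix with `shuffle *ᵥ vec (Zᵀ) = vec Z` for every
square `Z` of order `p`, where `vec` stacks columns. -/
def shuffle (p : ℕ) : Matrix (Fin p × Fin p) (Fin p × Fin p) ℝ :=
  Equiv.Perm.permMatrix ℝ (Equiv.prodComm (Fin p) (Fin p))

/-- The matrix `G_{jj}` for the family `A = 𝒜_j` of order `p = n_j`: the matrices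
`I_p ⊗ A_i - (A_iᵀ ⊗ I_p) Π` for `i = 1, …, m` are stacked, `Π` being the perfect shuffle. -/
def diagG {m p : ℕ} (A : Fin m → Matrix (Fin p) (Fin p) ℝ) :
    Matrix (Fin m × (Fin p × Fin p)) (Fin p × Fin p) ℝ :=
  Matrix.of fun r s =>
    ((1 : Matrix (Fin p) (Fin p) ℝ) ⊗ₖ A r.1
      - ((A r.1)ᵀ ⊗ₖ (1 : Matrix (Fin p) (Fin p) ℝ)) * shuffle p) r.2 s

/-- The modulus of uniqueness: the minimum over `j < k` of the smallest singular value of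
`G_{jk}`. -/
def omegaUq {m n : ℕ} (c : Composition n) (A : Fin m → Matrix (Fin n) (Fin n) ℝ)
    (W : Matrix (Fin n) (Fin n) ℝ) : ℝ :=
  ⨅ p : {p : Fin c.length × Fin c.length // p.1 < p.2},
    sigmaMin (offG (diagBlocks c A W p.1.1) (diagBlocks c A W p.1.2))

/-- The modulus of non-divisibility: the minimum over all `j` with `n_j > 1` of the smallest
nonzero singular value of `G_{jj}`, and `∞` if every `n_j` is `1`. -/
def omegaNd {m n : ℕ} (c : Composition n) (A : Fin m → Matrix (Fin n) (Fin n) ℝ)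
    (W : Matrix (Fin n) (Fin n) ℝ) : EReal :=
  ⨅ j : {j : Fin c.length // 1 < c.blocksFun j},
    ((sigmaMinNonzero (diagG (diagBlocks c A W j.1)) : ℝ) : EReal)

/-! ### The quantities of the perturbation bound -/

/-- `Γ = diag(γ₁ I_{n₁}, …, γ_t I_{n_t})`. -/
def gammaMat {n : ℕ} (c : Composition n) (γ : Fin c.length → ℝ) : Matrix (Fin n) (Fin n) ℝ :=
  Matrix.diagonal fun i => γ (c.index i)

/-- The residuals `R̃_i = W̃ᵀ Ã_i W̃ Γ - Γ W̃ᵀ Ã_i W̃`. -/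
def residual {m n : ℕ} (c : Composition n) (γ : Fin c.length → ℝ)
    (A' : Fin m → Matrix (Fin n) (Fin n) ℝ) (W' : Matrix (Fin n) (Fin n) ℝ) :
    Fin m → Matrix (Fin n) (Fin n) ℝ :=
  fun i => W'ᵀ * A' i * W' * gammaMat c γ - gammaMat c γ * (W'ᵀ * A' i * W')

/-- `g = min_{j ≠ k} |γ_j - γ_k|`. -/
def gap {t : ℕ} (γ : Fin t → ℝ) : ℝ :=
  ⨅ p : {p : Fin t × Fin t // p.1 ≠ p.2}, |γ p.1.1 - γ p.1.2|

/-- `r̃ = (∑ᵢ ‖R̃_i‖_F²)^{1/2}`. -/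
def rTilde {m n : ℕ} (c : Composition n) (γ : Fin c.length → ℝ)
    (A' : Fin m → Matrix (Fin n) (Fin n) ℝ) (W' : Matrix (Fin n) (Fin n) ℝ) : ℝ :=
  famNorm (residual c γ A' W')

/-- `δ_𝒜 = (∑ᵢ ‖ΔA_i‖_F²)^{1/2}`, where `ΔA_i = Ã_i - A_i`. -/
def deltaA {m n : ℕ} (A A' : Fin m → Matrix (Fin n) (Fin n) ℝ) : ℝ :=
  famNorm fun i => A' i - A i

/-- `δ = ‖Q⁻¹‖₂² r̃ + 2 ‖Q⁻¹‖₂ ‖W‖₂ ‖W̃‖₂ δ_𝒜`, where `Q = W⁻¹ W̃`. -/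
def delta {m n : ℕ} (c : Composition n) (γ : Fin c.length → ℝ)
    (A A' : Fin m → Matrix (Fin n) (Fin n) ℝ) (W W' : Matrix (Fin n) (Fin n) ℝ) : ℝ :=
  specNorm (W⁻¹ * W')⁻¹ ^ 2 * rTilde c γ A' W'
    + 2 * specNorm (W⁻¹ * W')⁻¹ * specNorm W * specNorm W' * deltaA A A'

/-- `τ = (√2 - 1) / √(t - 1)`. -/
def tauC (t : ℕ) : ℝ := (√2 - 1) / √((t : ℝ) - 1)

/-- `α = 2 τ / (√2 + τ)²`. -/
def alphaC (t : ℕ) : ℝ := 2 * tauC t / (√2 + tauC t) ^ 2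

/-- The smallness condition on `δ`:
`δ < min {α g ω_uq / κ₂(Q), (1 - 2α) g ω_nd / √2}`, where `Q = W⁻¹ W̃`. -/
def IsSmall {m n : ℕ} (c : Composition n) (γ : Fin c.length → ℝ)
    (A A' : Fin m → Matrix (Fin n) (Fin n) ℝ) (W W' : Matrix (Fin n) (Fin n) ℝ) : Prop :=
  ((delta c γ A A' W W' : ℝ) : EReal) <
    min ((alphaC c.length * gap γ * omegaUq c A W / cond₂ (W⁻¹ * W') : ℝ) : EReal)
      (((1 - 2 * alphaC c.length) * gap γ / √2 : ℝ) * omegaNd c A W)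

/-- All values `‖W - W̃ D Π‖ / ‖W̃‖` for orthogonal block diagonal `D` and block diagonal
preserving permutation matrices `Π`, for a matrix norm `nrm`. -/
def relErrors {n : ℕ} (c : Composition n) (nrm : Matrix (Fin n) (Fin n) ℝ → ℝ)
    (W W' : Matrix (Fin n) (Fin n) ℝ) : Set ℝ :=
  {e | ∃ D P : Matrix (Fin n) (Fin n) ℝ, IsBlockDiag c D ∧ Dᵀ * D = 1 ∧
    IsBlockPreservingPerm c P ∧ e = nrm (W - W' * D * P) / nrm W'}

end JBD

end

/-! Put `Q = Wᵀ W'` and `Z = Q Γ Qᵀ`, a symmetric matrix whose eigenvalues are the `γ_j`. If nothing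
were perturbed, `Z` would commute with every `B_i = Wᵀ A_i W`. In general the residuals `B_i Z - Zᵀ
B_i` have total Frobenius norm at most `δ`, because `Q` is orthogonal and `|γ_j| ≤ 1`
(`sum_frobSq_residual_le`).

Read block by block, these residuals are the linear systems with matrices `G_jk` and `G_jj`. With `ε
= δ / (g ω_uq)`, the off-diagonal part of `Z` has norm at most `ε g`. Each diagonal block is so
close to a scalar matrix that its eigenvalues spread by less than `(1 - 2ε) g`.

The core is `exists_blockDiag_mul_perm_near`. Diagonalize the diagonal blocks of `Z` and compare
entries in `Z Q = Q Γ`. Each eigenvalue lies within `ε g` of some `γ_k`, and the spread bound makes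
`k` constant on a block. Hence, after this rotation, `Q` has mass at most `ε / (1 - ε)` outside one
matched block per block row. Nonsingularity of the matched part makes the matching a permutation.
Replacing that part by its polar factor costs a factor `√2`.

This gives a distance of at most `√2 ε / (1 - ε) ≤ √2 ε + 3 ε²`, and `√2` is at most the leading
constant of the claim. The minimum is attained by compactness. -/

noncomputable section

namespace JBD

/-! ### Squared Frobenius norms -/

/-- The sum of the squares of the entries of a matrix. -/
def frobSq {ι κ : Type*} [Fintype ι] [Fintype κ] (A : Matrix ι κ ℝ) : ℝ :=
  ∑ i, ∑ j, A i j ^ 2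

section FrobSq

variable {ι κ μ : Type*} [Fintype ι] [Fintype κ] [Fintype μ]

theorem frobSq_nonneg (A : Matrix ι κ ℝ) : 0 ≤ frobSq A :=
  Finset.sum_nonneg fun _ _ => Finset.sum_nonneg fun _ _ => sq_nonneg _

theorem frobSq_eq_trace (A : Matrix ι κ ℝ) : frobSq A = (Aᵀ * A).trace := by
  simp only [frobSq, Matrix.trace, Matrix.diag, Matrix.mul_apply, Matrix.transpose_apply]
  rw [Finset.sum_comm]
  simp only [sq]

theorem frobSq_transpose (A : Matrix ι κ ℝ) : frobSq Aᵀ = frobSq A := by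
  simp only [frobSq, Matrix.transpose_apply]
  exact Finset.sum_comm

theorem frobSq_orthogonal_mul [DecidableEq ι] {U : Matrix ι ι ℝ} (hU : Uᵀ * U = 1)
    (A : Matrix ι κ ℝ) : frobSq (U * A) = frobSq A := by
  rw [frobSq_eq_trace, frobSq_eq_trace, Matrix.transpose_mul, Matrix.mul_assoc,
    ← Matrix.mul_assoc Uᵀ, hU, Matrix.one_mul]

theorem frobSq_mul_orthogonal [DecidableEq κ] {U : Matrix κ κ ℝ} (hU : U * Uᵀ = 1)
    (A : Matrix ι κ ℝ) : frobSq (A * U) = frobSq A := by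
  rw [← frobSq_transpose, Matrix.transpose_mul, frobSq_orthogonal_mul, frobSq_transpose]
  rwa [Matrix.transpose_transpose]

theorem sum_sq_mulVec_le (A : Matrix ι κ ℝ) (v : κ → ℝ) :
    ∑ i, (A *ᵥ v) i ^ 2 ≤ frobSq A * ∑ j, v j ^ 2 := by
  rw [frobSq, Finset.sum_mul]
  exact Finset.sum_le_sum fun i _ => Finset.sum_mul_sq_le_sq_mul_sq _ _ _

theorem frobSq_submatrix_equiv {ι' κ' : Type*} [Fintype ι'] [Fintype κ'] (A : Matrix ι κ ℝ)
    (e : ι' ≃ ι) (f : κ' ≃ κ) : frobSq (A.submatrix e f) = frobSq A := by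
  simp only [frobSq, Matrix.submatrix_apply]
  rw [Equiv.sum_comp e fun i => ∑ j, A i (f j) ^ 2]
  exact Finset.sum_congr rfl fun i _ => Equiv.sum_comp f fun j => A i j ^ 2

end FrobSq

/-! ### Matrices that are block diagonal along the fibres of a map -/

section Blocks

variable {ι κ : Type*}

/-- All entries of `A` outside of the diagonal blocks given by the fibres of `b` vanish. -/
def VanishesOff (b : ι → κ) (A : Matrix ι ι ℝ) : Prop :=
  ∀ i j, b i ≠ b j → A i j = 0

/-- The part of `A` inside the diagonal blocks given by the fibres of `b`. -/
def onPart [DecidableEq κ] (b : ι → κ) (A : Matrix ι ι ℝ) : Matrix ι ι ℝ :=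
  Matrix.of fun i j => if b i = b j then A i j else 0

/-- The part of `A` outside of the diagonal blocks given by the fibres of `b`. -/
def offPart [DecidableEq κ] (b : ι → κ) (A : Matrix ι ι ℝ) : Matrix ι ι ℝ :=
  Matrix.of fun i j => if b i = b j then 0 else A i j

theorem onPart_add_offPart [DecidableEq κ] (b : ι → κ) (A : Matrix ι ι ℝ) :
    onPart b A + offPart b A = A := by
  ext i j
  by_cases h : b i = b j <;> simp [onPart, offPart, h]

theorem vanishesOff_onPart [DecidableEq κ] (b : ι → κ) (A : Matrix ι ι ℝ) :
    VanishesOff b (onPart b A) := by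
  intro i j h
  simp [onPart, h]

theorem VanishesOff.transpose {b : ι → κ} {A : Matrix ι ι ℝ} (hA : VanishesOff b A) :
    VanishesOff b Aᵀ :=
  fun i j h => hA j i h.symm

variable [Fintype ι]

theorem VanishesOff.mul {b : ι → κ} {A B : Matrix ι ι ℝ} (hA : VanishesOff b A)
    (hB : VanishesOff b B) : VanishesOff b (A * B) := by
  intro i j h
  rw [Matrix.mul_apply]
  refine Finset.sum_eq_zero fun k _ => ?_
  by_cases hk : b i = b k
  · rw [hB k j (hk ▸ h), mul_zero]
  · rw [hA i k hk, zero_mul]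

variable [DecidableEq κ]

theorem VanishesOff.onPart_mul {b : ι → κ} {A : Matrix ι ι ℝ} (hA : VanishesOff b A)
    (B : Matrix ι ι ℝ) : onPart b (A * B) = A * onPart b B := by
  ext i j
  simp only [onPart, Matrix.of_apply, Matrix.mul_apply]
  split_ifs with h
  · refine Finset.sum_congr rfl fun k _ => ?_
    by_cases hk : b i = b k
    · rw [if_pos (hk.symm.trans h)]
    · rw [hA i k hk, zero_mul, zero_mul]
  · symm
    refine Finset.sum_eq_zero fun k _ => ?_
    by_cases hk : b i = b k
    · rw [if_neg (hk ▸ h), mul_zero]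
    · rw [hA i k hk, zero_mul]

theorem VanishesOff.offPart_mul {b : ι → κ} {A : Matrix ι ι ℝ} (hA : VanishesOff b A)
    (B : Matrix ι ι ℝ) : offPart b (A * B) = A * offPart b B := by
  have h1 := onPart_add_offPart b (A * B)
  have h2 := congrArg (A * ·) (onPart_add_offPart b B)
  simp only [Matrix.mul_add] at h2
  rw [hA.onPart_mul] at h1
  exact add_left_cancel (h1.trans h2.symm)

/-- A symmetric block diagonal matrix is diagonalized by an orthogonal block diagonal matrix. -/
theorem exists_blockDiag_diagonalizer [DecidableEq ι] [Fintype κ] (b : ι → κ) {S : Matrix ι ι ℝ}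
    (hS : Sᵀ = S) (hb : VanishesOff b S) :
    ∃ (V : Matrix ι ι ℝ) (s : ι → ℝ), Vᵀ * V = 1 ∧ V * Vᵀ = 1 ∧ VanishesOff b V ∧
      Vᵀ * S * V = Matrix.diagonal s := by
  classical
  -- The spectral theorem is applied to each fibre separately, so that the eigenvector matrix is
  -- block diagonal too.
  let e : (Σ y, {x // b x = y}) ≃ ι := Equiv.sigmaFiberEquiv b
  let T : ∀ y, Matrix {x // b x = y} {x // b x = y} ℝ := fun y =>
    S.submatrix Subtype.val Subtype.val
  have hT : ∀ y, (T y).IsHermitian := fun y => by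
    ext i j
    simpa [T] using congrFun (congrFun hS i.1) j.1
  let U : ∀ y, Matrix {x // b x = y} {x // b x = y} ℝ := fun y => (hT y).eigenvectorUnitary
  have hU : ∀ y, (U y)ᵀ * U y = 1 := fun y => by
    have := Unitary.coe_star_mul_self (hT y).eigenvectorUnitary
    rwa [Matrix.star_eq_conjTranspose, Matrix.conjTranspose_eq_transpose_of_trivial] at this
  have hUT : ∀ y, (U y)ᵀ * T y * U y = Matrix.diagonal (hT y).eigenvalues := fun y => by
    have := (hT y).conjStarAlgAut_star_eigenvectorUnitary
    rw [Unitary.conjStarAlgAut_star_apply, Matrix.star_eq_conjTranspose,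
      Matrix.conjTranspose_eq_transpose_of_trivial] at this
    simpa using this
  have hSe : S = (Matrix.blockDiagonal' T).submatrix e.symm e.symm := by
    ext i j
    rw [Matrix.submatrix_apply, Matrix.blockDiagonal'_apply]
    by_cases h : b i = b j
    · have h' : (e.symm i).1 = (e.symm j).1 := h
      rw [dif_pos h']
      -- `blockDiagonal'` transports the column index along an equality of fibres; the underlying
      -- element of `ι` is unchanged.
      have hcast : ∀ (y : κ) (hy : b j = y) (z : κ) (hz : z = y),
          (cast (congrArg (fun y => {x // b x = y}) hz.symm)
            (⟨j, hy⟩ : {x // b x = y})).1 = j := by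
        rintro y hy z rfl
        rfl
      simp only [T, Matrix.submatrix_apply]
      exact congrArg (S i) (hcast _ rfl _ h).symm
    · have h' : ¬ (e.symm i).1 = (e.symm j).1 := h
      rw [dif_neg h', hb i j h]
  let V : Matrix ι ι ℝ := (Matrix.blockDiagonal' U).submatrix e.symm e.symm
  have hV : Vᵀ * V = 1 := by
    simp only [V, Matrix.transpose_submatrix, Matrix.blockDiagonal'_transpose,
      Matrix.submatrix_mul_equiv, ← Matrix.blockDiagonal'_mul, hU]
    have : Matrix.blockDiagonal' (fun y => (1 : Matrix {x // b x = y} {x // b x = y} ℝ)) = 1 :=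
      Matrix.blockDiagonal'_one
    rw [this, Matrix.submatrix_one_equiv]
  refine ⟨V, fun i => (hT _).eigenvalues (e.symm i).2, hV, mul_eq_one_comm.mp hV, ?_, ?_⟩
  · intro i j h
    have h' : ¬ (e.symm i).1 = (e.symm j).1 := h
    simp only [V, Matrix.submatrix_apply, Matrix.blockDiagonal'_apply]
    rw [dif_neg h']
  · conv_lhs => rw [hSe]
    simp only [V, Matrix.transpose_submatrix, Matrix.blockDiagonal'_transpose,
      Matrix.submatrix_mul_equiv, ← Matrix.blockDiagonal'_mul, hUT]
    rw [Matrix.blockDiagonal'_diagonal, Matrix.submatrix_diagonal_equiv]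
    rfl

/-- An orthogonal matrix whose off-diagonal blocks are small is close to an orthogonal block
diagonal matrix. -/
theorem exists_blockDiag_orthogonal_near [DecidableEq ι] [Fintype κ] (b : ι → κ)
    {Y : Matrix ι ι ℝ} (hY : Y * Yᵀ = 1) (hoff : frobSq (offPart b Y) < 1) :
    ∃ D : Matrix ι ι ℝ, VanishesOff b D ∧ Dᵀ * D = 1 ∧
      frobSq (Y - D) ≤ 2 * frobSq (offPart b Y) := by
  set N := onPart b Y with hN
  have hNv : VanishesOff b N := vanishesOff_onPart b Y
  -- The matrix sought is the polar factor `(N Nᵀ)^(-1/2) N`. In an eigenbasis of `N Nᵀ` the rows of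
  -- `N` are orthogonal, so it arises by normalizing rows.
  obtain ⟨V, s, hV, hV', hVb, hVs⟩ := exists_blockDiag_diagonalizer b (S := N * Nᵀ)
    (by rw [Matrix.transpose_mul, Matrix.transpose_transpose]) (hNv.mul hNv.transpose)
  set Y₁ := Vᵀ * Y with hY₁
  have hY₁o : Y₁ * Y₁ᵀ = 1 := by
    rw [hY₁, Matrix.transpose_mul, Matrix.transpose_transpose, Matrix.mul_assoc,
      ← Matrix.mul_assoc Y, hY, Matrix.one_mul, hV]
  set N₁ := onPart b Y₁ with hN₁
  have hN₁e : N₁ = Vᵀ * N := hVb.transpose.onPart_mul Y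
  have hE₁e : offPart b Y₁ = Vᵀ * offPart b Y := hVb.transpose.offPart_mul Y
  have hE₁ : frobSq (offPart b Y₁) = frobSq (offPart b Y) := by
    rw [hE₁e, frobSq_orthogonal_mul]
    rwa [Matrix.transpose_transpose]
  have hNN : N₁ * N₁ᵀ = Matrix.diagonal s := by
    rw [hN₁e, Matrix.transpose_mul, Matrix.transpose_transpose, ← hVs]
    simp only [Matrix.mul_assoc]
  set o : ι → ℝ := fun i => ∑ j, offPart b Y₁ i j ^ 2 with ho
  have hsum : ∑ i, o i = frobSq (offPart b Y) := hE₁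
  have ho0 : ∀ i, 0 ≤ o i := fun i => Finset.sum_nonneg fun _ _ => sq_nonneg _
  -- This is where `hoff` enters: no row of `N₁` vanishes, so all can be normalized.
  have ho1 : ∀ i, o i < 1 := fun i =>
    (Finset.single_le_sum (fun i _ => ho0 i) (Finset.mem_univ i)).trans_lt (hsum ▸ hoff)
  have hs : ∀ i, s i = ∑ j, N₁ i j ^ 2 := fun i => by
    have := congrFun (congrFun hNN i) i
    rw [Matrix.diagonal_apply_eq, Matrix.mul_apply] at this
    simp only [← this, Matrix.transpose_apply, sq]
  have hso : ∀ i, s i + o i = 1 := fun i => by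
    have := congrFun (congrFun hY₁o i) i
    rw [Matrix.one_apply_eq, Matrix.mul_apply] at this
    rw [hs, ho, ← Finset.sum_add_distrib, ← this]
    refine Finset.sum_congr rfl fun j _ => ?_
    by_cases h : b i = b j <;> simp [hN₁, onPart, offPart, h, sq]
  have hs0 : ∀ i, 0 < s i := fun i => by linarith [hso i, ho1 i]
  set D₁ : Matrix ι ι ℝ := Matrix.diagonal (fun i => (√(s i))⁻¹) * N₁ with hD₁
  have hD₁o : D₁ * D₁ᵀ = 1 := by
    rw [hD₁, Matrix.transpose_mul, Matrix.diagonal_transpose, Matrix.mul_assoc,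
      ← Matrix.mul_assoc N₁, hNN, Matrix.diagonal_mul_diagonal, Matrix.diagonal_mul_diagonal,
      ← Matrix.diagonal_one]
    congr 1
    funext i
    have h := Real.sqrt_pos.mpr (hs0 i)
    have h2 := Real.mul_self_sqrt (hs0 i).le
    field_simp
    linarith
  have hD₁b : VanishesOff b D₁ := by
    intro i j h
    rw [hD₁, Matrix.diagonal_mul, hN₁, vanishesOff_onPart b Y₁ i j h, mul_zero]
  refine ⟨V * D₁, hVb.mul hD₁b, ?_, ?_⟩
  · rw [Matrix.transpose_mul, Matrix.mul_assoc, ← Matrix.mul_assoc Vᵀ, hV, Matrix.one_mul]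
    exact mul_eq_one_comm.mp hD₁o
  · have hYV : Y = V * Y₁ := by rw [hY₁, ← Matrix.mul_assoc, hV', Matrix.one_mul]
    rw [hYV, ← Matrix.mul_sub, frobSq_orthogonal_mul hV, ← hYV, ← hsum, frobSq, Finset.mul_sum]
    refine Finset.sum_le_sum fun i _ => ?_
    have hrow : ∑ j, (Y₁ - D₁) i j ^ 2 = o i + (1 - (√(s i))⁻¹) ^ 2 * s i := by
      rw [hs i, ho, Finset.mul_sum, ← Finset.sum_add_distrib, ← hs i]
      refine Finset.sum_congr rfl fun j _ => ?_
      rw [Matrix.sub_apply, hD₁, Matrix.diagonal_mul]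
      by_cases h : b i = b j
      · simp [hN₁, onPart, offPart, h]
        ring
      · simp [hN₁, onPart, offPart, h]
    rw [hrow]
    have h := Real.sqrt_pos.mpr (hs0 i)
    have h2 := Real.sq_sqrt (hs0 i).le
    have h3 : (1 - (√(s i))⁻¹) ^ 2 * s i = (√(s i) - 1) ^ 2 := by
      generalize √(s i) = r at h h2
      rw [← h2]
      field_simp
    rw [h3]
    have h4 : √(s i) ≤ 1 := Real.sqrt_le_one.mpr (by linarith [hso i, ho0 i])
    -- With `s + o = 1` the row error is `o + (√s - 1)² = 2 - 2√s ≤ 2 - 2s = 2o`.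
    nlinarith [hso i]

end Blocks

/-! ### Rotation of invariant subspaces and matching of blocks. -/

section Rotation

variable {ι κ : Type*} [Fintype ι] [DecidableEq ι] [DecidableEq κ]

theorem VanishesOff.commute_diagonal {b : ι → κ} {V : Matrix ι ι ℝ} (hV : VanishesOff b V)
    (f : κ → ℝ) :
    V * Matrix.diagonal (fun i => f (b i)) = Matrix.diagonal (fun i => f (b i)) * V := by
  ext i j
  rw [Matrix.mul_diagonal, Matrix.diagonal_mul]
  by_cases h : b i = b j
  · rw [h, mul_comm]
  · rw [hV i j h, zero_mul, mul_zero]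

theorem mul_permMatrix_apply (X : Matrix ι ι ℝ) (σ : Equiv.Perm ι) (i j : ι) :
    (X * σ.permMatrix ℝ) i j = X i (σ.symm j) := by
  rw [Matrix.mul_apply, Finset.sum_eq_single (σ.symm j)]
  · simp [Equiv.Perm.permMatrix, PEquiv.toMatrix_apply]
  · intro k _ hk
    have : ¬ σ k = j := fun h => hk (by rw [← h, Equiv.symm_apply_apply])
    simp [Equiv.Perm.permMatrix, PEquiv.toMatrix_apply, this]
  · simp

theorem permMatrix_transpose_mul_apply (X : Matrix ι ι ℝ) (σ : Equiv.Perm ι) (i j : ι) :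
    ((σ.permMatrix ℝ)ᵀ * X) i j = X (σ.symm i) j := by
  have := mul_permMatrix_apply Xᵀ σ j i
  rw [← Matrix.transpose_apply (Xᵀ * _), Matrix.transpose_mul, Matrix.transpose_transpose] at this
  exact this

theorem permMatrix_mul_transpose (σ : Equiv.Perm ι) :
    σ.permMatrix ℝ * (σ.permMatrix ℝ)ᵀ = 1 := by
  rw [mul_eq_one_comm]
  ext i j
  rw [permMatrix_transpose_mul_apply]
  simp [Equiv.Perm.permMatrix, PEquiv.toMatrix_apply, Matrix.one_apply]

/-- If a part `N` of an orthogonal matrix `Q`, supported where `p i j` holds, misses `Q` by less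
than `1` in the Frobenius norm, then some permutation is contained in the support. -/
theorem exists_perm_of_near_orthogonal {Q N : Matrix ι ι ℝ} (hQ : Qᵀ * Q = 1)
    (hN : frobSq (Q - N) < 1) {p : ι → ι → Prop} (hp : ∀ i j, ¬ p i j → N i j = 0) :
    ∃ σ : Equiv.Perm ι, ∀ i, p (σ i) i := by
  -- If `N v = 0` with `v ≠ 0`, then `‖v‖ = ‖Q v‖ = ‖(Q - N) v‖ < ‖v‖`.
  have hdet : N.det ≠ 0 := by
    intro h0
    obtain ⟨v, hv, hv0⟩ := Matrix.exists_mulVec_eq_zero_iff.mpr h0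
    have h1 : ∑ i, (Q *ᵥ v) i ^ 2 = ∑ i, v i ^ 2 := by
      have : (Q *ᵥ v) ⬝ᵥ (Q *ᵥ v) = v ⬝ᵥ v := by
        rw [Matrix.dotProduct_mulVec, Matrix.vecMul_mulVec, hQ, Matrix.vecMul_one]
      simpa only [dotProduct, ← sq] using this
    have h2 := sum_sq_mulVec_le (Q - N) v
    rw [Matrix.sub_mulVec, hv0, sub_zero, h1] at h2
    have h3 : 0 < ∑ i, v i ^ 2 := by
      obtain ⟨i, hi⟩ := Function.ne_iff.mp hv
      exact Finset.sum_pos' (fun _ _ => sq_nonneg _) ⟨i, Finset.mem_univ i, by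
        have : v i ≠ 0 := hi
        positivity⟩
    nlinarith
  -- A nonzero term of the Leibniz expansion is a permutation inside the support of `N`.
  rw [Matrix.det_apply] at hdet
  obtain ⟨σ, _, hσ⟩ := Finset.exists_ne_zero_of_sum_ne_zero hdet
  refine ⟨σ, fun i => by_contra fun hi => hσ ?_⟩
  have h0 : ∏ j, N (σ j) j = 0 := Finset.prod_eq_zero (Finset.mem_univ i) (hp _ _ hi)
  exact (congrArg _ h0).trans (smul_zero _)

variable [Fintype κ]

/-- The rotation of the invariant subspaces: if `Q Γ Qᵀ` is nearly block diagonal and the spread of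
the spectrum of its diagonal blocks is smaller than the gap of `Γ`, then `Qᵀ` is close to the product
of an orthogonal block diagonal matrix and a permutation matrix that permutes the blocks. -/
theorem exists_blockDiag_mul_perm_near (b : ι → κ) (hb : Function.Surjective b) (γ : κ → ℝ)
    {g ε : ℝ} (hg : 0 < g) (hγ : ∀ j k, j ≠ k → g ≤ |γ j - γ k|) (hε0 : 0 ≤ ε)
    (hε : ε < 2 / 5) {Q : Matrix ι ι ℝ} (hQ : Q * Qᵀ = 1) {Z : Matrix ι ι ℝ}
    (hZ : Z = Q * Matrix.diagonal (fun i => γ (b i)) * Qᵀ)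
    (hoff : frobSq (offPart b Z) ≤ (ε * g) ^ 2)
    (hdiag : ∀ j, ∃ z : ℝ, 2 * frobSq (Matrix.diagonal (fun i => if b i = j then (1 : ℝ) else 0) *
      (onPart b Z - z • (1 : Matrix ι ι ℝ))) < ((1 - 2 * ε) * g) ^ 2) :
    ∃ (D : Matrix ι ι ℝ) (σ : Equiv.Perm ι), VanishesOff b D ∧ Dᵀ * D = 1 ∧
      (∀ i j, b (σ i) = b (σ j) ↔ b i = b j) ∧
      (1 - ε) ^ 2 * frobSq (Qᵀ - D * σ.permMatrix ℝ) ≤ 2 * ε ^ 2 := by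
  have hQ' : Qᵀ * Q = 1 := mul_eq_one_comm.mp hQ
  have hZs : Zᵀ = Z := by
    rw [hZ]
    simp [Matrix.transpose_mul, Matrix.mul_assoc]
  obtain ⟨V, l, hV, hV', hVb, hVl⟩ := exists_blockDiag_diagonalizer b (S := onPart b Z)
    (by
      ext i j
      have := congrFun (congrFun hZs i) j
      rw [Matrix.transpose_apply] at this
      simp [onPart, this, eq_comm]) (vanishesOff_onPart b Z)
  set Q₁ := Vᵀ * Q with hQ₁
  set E := Vᵀ * offPart b Z * V with hE
  have hQ₁o : Q₁ * Q₁ᵀ = 1 := by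
    rw [hQ₁, Matrix.transpose_mul, Matrix.transpose_transpose, Matrix.mul_assoc,
      ← Matrix.mul_assoc Q, hQ, Matrix.one_mul, hV]
  have hQ₁o' : Q₁ᵀ * Q₁ = 1 := mul_eq_one_comm.mp hQ₁o
  have hEn : frobSq (E * Q₁) ≤ (ε * g) ^ 2 := by
    rw [frobSq_mul_orthogonal hQ₁o, hE, frobSq_mul_orthogonal hV', frobSq_orthogonal_mul]
    · exact hoff
    · rwa [Matrix.transpose_transpose]
  -- This is `Z Q = Q Γ` after multiplication by `Vᵀ`, with `Z` split into its diagonal and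
  -- off-diagonal blocks.
  have hentry : ∀ i j, (γ (b j) - l i) * Q₁ i j = (E * Q₁) i j := by
    have h1 : Matrix.diagonal l * Q₁ + E * Q₁ = Q₁ * Matrix.diagonal (fun i => γ (b i)) := by
      have hc : ∀ X : Matrix ι ι ℝ, Vᵀ * X * V * Q₁ = Vᵀ * (X * Q) := fun X => by
        rw [hQ₁, Matrix.mul_assoc, ← Matrix.mul_assoc V, hV', Matrix.one_mul, Matrix.mul_assoc]
      rw [← hVl, hE, hc, hc, ← Matrix.mul_add, ← Matrix.add_mul, onPart_add_offPart, hZ, hQ₁,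
        Matrix.mul_assoc (Q * _), hQ', Matrix.mul_one, Matrix.mul_assoc]
    intro i j
    have := congrFun (congrFun h1 i) j
    rw [Matrix.add_apply, Matrix.diagonal_mul, Matrix.mul_diagonal] at this
    linarith
  have hrow : ∀ i, ∑ j, Q₁ i j ^ 2 = 1 := fun i => by
    have := congrFun (congrFun hQ₁o i) i
    rw [Matrix.one_apply_eq, Matrix.mul_apply] at this
    simpa only [Matrix.transpose_apply, ← sq] using this
  -- Otherwise row `i` of `E Q₁` would have norm above `ε g`, since row `i` of `Q₁` is a unit
  -- vector.
  have hnear : ∀ i, ∃ k, |γ k - l i| ≤ ε * g := by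
    intro i
    by_contra! hcon
    have h1 : ∑ j, (E * Q₁) i j ^ 2 ≤ (ε * g) ^ 2 :=
      (Finset.single_le_sum (f := fun i => ∑ j, (E * Q₁) i j ^ 2)
        (fun _ _ => Finset.sum_nonneg fun _ _ => sq_nonneg _) (Finset.mem_univ i)).trans hEn
    have h2 : ∑ j, (ε * g) ^ 2 * Q₁ i j ^ 2 < ∑ j, (E * Q₁) i j ^ 2 := by
      have hlt : ∀ j, (ε * g) ^ 2 < (γ (b j) - l i) ^ 2 := fun j => by
        rw [← sq_abs (γ (b j) - l i)]
        exact pow_lt_pow_left₀ (hcon (b j)) (by positivity) two_ne_zero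
      refine Finset.sum_lt_sum (fun j _ => ?_) ?_
      · rw [← hentry, mul_pow (_ - _)]
        exact mul_le_mul_of_nonneg_right (hlt j).le (sq_nonneg _)
      · have : ∃ j ∈ Finset.univ, Q₁ i j ^ 2 ≠ 0 := by
          apply Finset.exists_ne_zero_of_sum_ne_zero
          rw [hrow]
          exact one_ne_zero
        obtain ⟨j, hj, hj0⟩ := this
        refine ⟨j, hj, ?_⟩
        rw [← hentry, mul_pow (_ - _)]
        exact mul_lt_mul_of_pos_right (hlt j) ((sq_nonneg _).lt_of_ne' hj0)
    rw [← Finset.mul_sum, hrow, mul_one] at h2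
    exact absurd h1 (not_le.mpr h2)
  -- The factor `2` in `hdiag` comes from `(x - y)² ≤ 2 ((x - z)² + (y - z)²)` for two eigenvalues
  -- of the same block.
  have hspread : ∀ i i', b i = b i' → |l i - l i'| < (1 - 2 * ε) * g := by
    intro i i' hii
    rcases eq_or_ne i i' with rfl | hne
    · rw [sub_self, abs_zero]
      have : 0 < 1 - 2 * ε := by linarith
      positivity
    obtain ⟨z, hz⟩ := hdiag (b i)
    set P : Matrix ι ι ℝ := Matrix.diagonal (fun k => if b k = b i then (1 : ℝ) else 0) with hP
    have hPV : Vᵀ * P = P * Vᵀ :=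
      hVb.transpose.commute_diagonal fun k => if k = b i then (1 : ℝ) else 0
    have hrot : frobSq (P * (onPart b Z - z • (1 : Matrix ι ι ℝ)))
        = frobSq (P * Matrix.diagonal (fun k => l k - z)) := by
      rw [← frobSq_orthogonal_mul (U := Vᵀ) (by rwa [Matrix.transpose_transpose]),
        ← frobSq_mul_orthogonal hV', ← Matrix.mul_assoc, hPV, Matrix.mul_assoc, Matrix.mul_assoc,
        ← Matrix.mul_assoc Vᵀ, Matrix.mul_sub, Matrix.sub_mul, hVl, Matrix.mul_smul,
        Matrix.mul_one, Matrix.smul_mul, hV]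
      congr 2
      ext k k'
      by_cases h : k = k' <;> simp [h]
    have hsum : (l i - z) ^ 2 + (l i' - z) ^ 2
        ≤ frobSq (P * Matrix.diagonal (fun k => l k - z)) := by
      have hval : ∀ k, b k = b i →
          (l k - z) ^ 2 ≤ ∑ j, (P * Matrix.diagonal (fun k => l k - z)) k j ^ 2 := by
        intro k hk
        refine le_trans (le_of_eq ?_) (Finset.single_le_sum
          (f := fun j => (P * Matrix.diagonal (fun k => l k - z)) k j ^ 2)
          (fun _ _ => sq_nonneg _) (Finset.mem_univ k))
        simp [hP, hk]
      rw [frobSq]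
      refine le_trans ?_ (Finset.sum_le_sum_of_subset_of_nonneg (Finset.subset_univ {i, i'})
        fun _ _ _ => Finset.sum_nonneg fun _ _ => sq_nonneg _)
      rw [Finset.sum_pair hne]
      exact add_le_add (hval i rfl) (hval i' hii.symm)
    rw [hrot] at hz
    have hpos : 0 < (1 - 2 * ε) * g := mul_pos (by linarith) hg
    refine abs_lt_of_sq_lt_sq ?_ hpos.le
    nlinarith [sq_nonneg (l i - z + (l i' - z))]
  choose k hk using hnear
  -- Two different labels would give `g < ε g + (1 - 2ε) g + ε g = g`.
  have hkconst : ∀ i i', b i = b i' → k i = k i' := by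
    intro i i' hii
    by_contra hne
    have h1 := hγ _ _ hne
    have h2 := hspread i i' hii
    have h3 : |γ (k i) - γ (k i')| ≤ |γ (k i) - l i| + |l i - l i'| + |γ (k i') - l i'| := by
      have e : γ (k i) - γ (k i') = (γ (k i) - l i) + (l i - l i') - (γ (k i') - l i') := by ring
      rw [e]
      exact (abs_sub _ _).trans (add_le_add_left (abs_add_le _ _) _)
    linarith [hk i, hk i']
  let q : κ → κ := fun j => k (Function.surjInv hb j)
  have hq : ∀ i, q (b i) = k i := fun i => hkconst _ _ (Function.surjInv_eq hb (b i))
  let N : Matrix ι ι ℝ := Matrix.of fun i j => if q (b i) = b j then Q₁ i j else 0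
  -- Outside the matched blocks the divisor `γ (b j) - l i` has modulus at least `g - ε g`.
  have hoffN : (1 - ε) ^ 2 * frobSq (Q₁ - N) ≤ ε ^ 2 := by
    have h1 : (g * (1 - ε)) ^ 2 * frobSq (Q₁ - N) ≤ frobSq (E * Q₁) := by
      rw [frobSq, frobSq, Finset.mul_sum]
      refine Finset.sum_le_sum fun i _ => ?_
      rw [Finset.mul_sum]
      refine Finset.sum_le_sum fun j _ => ?_
      rw [Matrix.sub_apply, ← hentry, mul_pow (_ - _)]
      by_cases h : q (b i) = b j
      · simp [N, h]
        positivity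
      · have h2 : g * (1 - ε) ≤ |γ (b j) - l i| := by
          have h3 := hγ (b j) (k i) (fun h' => h ((hq i).trans h'.symm))
          have h4 := abs_sub_le (γ (b j)) (l i) (γ (k i))
          rw [abs_sub_comm (l i)] at h4
          linarith [hk i]
        have h3 : (g * (1 - ε)) ^ 2 ≤ (γ (b j) - l i) ^ 2 := by
          rw [← sq_abs (γ (b j) - l i)]
          exact pow_le_pow_left₀ (mul_nonneg hg.le (by linarith)) h2 2
        simpa [N, h] using mul_le_mul_of_nonneg_right h3 (sq_nonneg (Q₁ i j))
    have h2 : g ^ 2 * ((1 - ε) ^ 2 * frobSq (Q₁ - N)) ≤ g ^ 2 * ε ^ 2 := by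
      calc _ = (g * (1 - ε)) ^ 2 * frobSq (Q₁ - N) := by ring
        _ ≤ (ε * g) ^ 2 := h1.trans hEn
        _ = _ := by ring
    exact le_of_mul_le_mul_left h2 (by positivity)
  have hlt1 : frobSq (Q₁ - N) < 1 := by
    by_contra! h
    have : (1 - ε) ^ 2 * 1 ≤ ε ^ 2 :=
      (mul_le_mul_of_nonneg_left h (sq_nonneg _)).trans hoffN
    nlinarith
  obtain ⟨σ, hσ⟩ := exists_perm_of_near_orthogonal hQ₁o' hlt1
    (p := fun i j => q (b i) = b j) (fun i j h => by simp [N, h])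
  -- Every block index is `b i = q (b (σ i))`, so `q` is onto, hence bijective by finiteness.
  have hqb : Function.Bijective q := by
    refine Finite.surjective_iff_bijective.mp fun j => ?_
    obtain ⟨i, rfl⟩ := hb j
    exact ⟨_, hσ i⟩
  have hσb : ∀ i j, b (σ i) = b (σ j) ↔ b i = b j := fun i j => by
    rw [← hσ i, ← hσ j, hqb.1.eq_iff]
  set P := σ.permMatrix ℝ with hP
  have hPP : P * Pᵀ = 1 := permMatrix_mul_transpose σ
  have hPP' : Pᵀ * P = 1 := mul_eq_one_comm.mp hPP
  have hmulPT : ∀ (X : Matrix ι ι ℝ) i j, (X * Pᵀ) i j = X i (σ j) := fun X i j => by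
    have := permMatrix_transpose_mul_apply (P * Xᵀ) σ (σ j) i
    rw [← Matrix.mul_assoc, ← hP, hPP', Matrix.one_mul, Equiv.symm_apply_apply] at this
    rw [← Matrix.transpose_apply (X * Pᵀ), Matrix.transpose_mul, Matrix.transpose_transpose, ← this,
      Matrix.transpose_apply]
  -- Permuting columns moves the matched blocks onto the diagonal, so the polar factor estimate
  -- applies to `Y`.
  set Y := Q₁ᵀ * Pᵀ with hY
  have hYo : Y * Yᵀ = 1 := by
    rw [hY, Matrix.transpose_mul _ Pᵀ, Matrix.transpose_transpose, Matrix.transpose_transpose,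
      Matrix.mul_assoc, ← Matrix.mul_assoc Pᵀ, hPP', Matrix.one_mul, hQ₁o']
  have hYoff : frobSq (offPart b Y) = frobSq (Q₁ - N) := by
    have : offPart b Y = (Q₁ - N)ᵀ.submatrix (Equiv.refl ι) σ := by
      ext i j
      have h1 : (b i = b j) ↔ (q (b (σ j)) = b i) := by rw [hσ j, eq_comm]
      simp only [offPart, Matrix.of_apply, hY, hmulPT, Matrix.submatrix_apply, Equiv.refl_apply,
        Matrix.transpose_apply, Matrix.sub_apply, N]
      by_cases h : b i = b j
      · rw [if_pos h, if_pos (h1.mp h), sub_self]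
      · rw [if_neg h, if_neg (fun h' => h (h1.mpr h')), sub_zero]
    rw [this, frobSq_submatrix_equiv, frobSq_transpose]
  obtain ⟨D', hD'b, hD'o, hD'n⟩ := exists_blockDiag_orthogonal_near b hYo (hYoff ▸ hlt1)
  -- From `Qᵀ = Y P Vᵀ`, the rotation `Vᵀ` must be moved to the left of `P`. It stays block diagonal
  -- because `σ` maps blocks to blocks.
  have hWb : VanishesOff b (P * Vᵀ * Pᵀ) := by
    intro i j h
    have : (P * Vᵀ * Pᵀ) i j = Vᵀ (σ i) (σ j) := by
      rw [hmulPT]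
      have := permMatrix_transpose_mul_apply (P * Vᵀ) σ (σ i) (σ j)
      rw [← Matrix.mul_assoc, ← hP, hPP', Matrix.one_mul, Equiv.symm_apply_apply] at this
      exact this.symm
    rw [this]
    exact hVb.transpose _ _ (fun h' => h ((hσb i j).mp h'))
  refine ⟨D' * (P * Vᵀ * Pᵀ), σ, hD'b.mul hWb, ?_, hσb, ?_⟩
  · have e : (P * Vᵀ * Pᵀ)ᵀ * (P * Vᵀ * Pᵀ) = 1 := by
      calc (P * Vᵀ * Pᵀ)ᵀ * (P * Vᵀ * Pᵀ) = P * V * (Pᵀ * P) * Vᵀ * Pᵀ := by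
            simp only [Matrix.transpose_mul, Matrix.transpose_transpose, Matrix.mul_assoc]
        _ = P * (V * Vᵀ) * Pᵀ := by rw [hPP', Matrix.mul_one, Matrix.mul_assoc P]
        _ = 1 := by rw [hV', Matrix.mul_one, hPP]
    rw [Matrix.transpose_mul, Matrix.mul_assoc, ← Matrix.mul_assoc D'ᵀ, hD'o, Matrix.one_mul, e]
  · have e : Qᵀ - D' * (P * Vᵀ * Pᵀ) * P = (Y - D') * (P * Vᵀ) := by
      have hQt : Qᵀ = Y * (P * Vᵀ) := by
        rw [hY, Matrix.mul_assoc, ← Matrix.mul_assoc Pᵀ, hPP', Matrix.one_mul, hQ₁,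
          Matrix.transpose_mul, Matrix.transpose_transpose, Matrix.mul_assoc, hV', Matrix.mul_one]
      rw [hQt, Matrix.sub_mul]
      congr 1
      rw [Matrix.mul_assoc, Matrix.mul_assoc (P * Vᵀ), hPP', Matrix.mul_one]
    rw [e, frobSq_mul_orthogonal]
    · rw [hYoff] at hD'n
      nlinarith [mul_le_mul_of_nonneg_left hD'n (sq_nonneg (1 - ε))]
    · rw [Matrix.transpose_mul, Matrix.transpose_transpose, Matrix.mul_assoc, ← Matrix.mul_assoc Vᵀ,
        hV, Matrix.one_mul, hPP]

end Rotation

/-! ### Lower bounds by singular values -/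

section SingularValues

variable {E F : Type*} [NormedAddCommGroup E] [InnerProductSpace ℝ E] [FiniteDimensional ℝ E]
  [NormedAddCommGroup F] [InnerProductSpace ℝ F] [FiniteDimensional ℝ F]

/-- Parseval for `⟪x, T* T x⟫` in the eigenbasis of `T* T`, whose eigenvalues are the squared
singular values. -/
theorem norm_sq_eq_sum_singularValues (T : E →ₗ[ℝ] F) (x : E) :
    ‖T x‖ ^ 2 = ∑ i : Fin (Module.finrank ℝ E), T.singularValues i ^ 2 *
      inner ℝ (T.isSymmetric_adjoint_comp_self.eigenvectorBasis rfl i) x ^ 2 := by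
  have hT := T.isSymmetric_adjoint_comp_self
  rw [← real_inner_self_eq_norm_sq, ← LinearMap.adjoint_inner_right, ← LinearMap.comp_apply,
    ← (hT.eigenvectorBasis rfl).sum_inner_mul_inner]
  refine Finset.sum_congr rfl fun i _ => ?_
  rw [← hT, hT.apply_eigenvectorBasis, real_inner_smul_left, T.sq_singularValues_fin rfl i,
    real_inner_comm x]
  simp only [RCLike.ofReal_real_eq_id, id]
  ring

theorem singularValues_last_sq_mul_norm_sq_le (T : E →ₗ[ℝ] F) (x : E) :
    T.singularValues (Module.finrank ℝ E - 1) ^ 2 * ‖x‖ ^ 2 ≤ ‖T x‖ ^ 2 := by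
  rw [norm_sq_eq_sum_singularValues,
    ← (T.isSymmetric_adjoint_comp_self.eigenvectorBasis rfl).sum_sq_inner_right x, Finset.mul_sum]
  refine Finset.sum_le_sum fun i _ => mul_le_mul_of_nonneg_right ?_ (sq_nonneg _)
  exact pow_le_pow_left₀ (T.singularValues_nonneg _) (T.singularValues_antitone (by omega)) 2

/-- Right singular vectors with singular value zero lie in the kernel, so `x` has no component along
them. If all singular values vanish, the `sInf` is `0` and the bound is trivial. -/
theorem sInf_singularValues_sq_mul_norm_sq_le (T : E →ₗ[ℝ] F) (x : E)
    (hx : ∀ y, T y = 0 → inner ℝ y x = 0) :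
    sInf {s : ℝ | s ≠ 0 ∧ ∃ i : ℕ, s = T.singularValues i} ^ 2 * ‖x‖ ^ 2 ≤ ‖T x‖ ^ 2 := by
  have hbdd : ∀ s ∈ {s : ℝ | s ≠ 0 ∧ ∃ i : ℕ, s = T.singularValues i}, 0 ≤ s := by
    rintro s ⟨_, i, rfl⟩
    exact T.singularValues_nonneg i
  rw [norm_sq_eq_sum_singularValues,
    ← (T.isSymmetric_adjoint_comp_self.eigenvectorBasis rfl).sum_sq_inner_right x, Finset.mul_sum]
  refine Finset.sum_le_sum fun i _ => ?_
  by_cases h : T.singularValues i = 0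
  · have hker : T (T.isSymmetric_adjoint_comp_self.eigenvectorBasis rfl i) = 0 := by
      have h1 := norm_sq_eq_sum_singularValues T
        (T.isSymmetric_adjoint_comp_self.eigenvectorBasis rfl i)
      rw [Finset.sum_eq_zero, sq_eq_zero_iff, norm_eq_zero] at h1
      · exact h1
      · intro j _
        rw [orthonormal_iff_ite.mp
          (T.isSymmetric_adjoint_comp_self.eigenvectorBasis rfl).orthonormal j i]
        by_cases hj : j = i
        · simp [hj, h]
        · simp [hj]
    rw [hx _ hker]
    simp
  · refine mul_le_mul_of_nonneg_right ?_ (sq_nonneg _)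
    exact pow_le_pow_left₀ (Real.sInf_nonneg hbdd) (csInf_le ⟨0, hbdd⟩ ⟨h, i, rfl⟩) 2

end SingularValues

section SigmaMin

variable {R K : Type*} [Fintype R] [DecidableEq R] [Fintype K] [DecidableEq K]

theorem sigmaMin_sq_mul_le (G : Matrix R K ℝ) (x : K → ℝ) :
    sigmaMin G ^ 2 * ∑ k, x k ^ 2 ≤ ∑ r, (G *ᵥ x) r ^ 2 := by
  have h := singularValues_last_sq_mul_norm_sq_le (Matrix.toEuclideanLin G) (WithLp.toLp 2 x)
  rw [finrank_euclideanSpace, EuclideanSpace.real_norm_sq_eq, EuclideanSpace.real_norm_sq_eq] at h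
  exact h

theorem sigmaMinNonzero_sq_mul_le (G : Matrix R K ℝ) (x : K → ℝ)
    (hx : ∀ y, G *ᵥ y = 0 → y ⬝ᵥ x = 0) :
    sigmaMinNonzero G ^ 2 * ∑ k, x k ^ 2 ≤ ∑ r, (G *ᵥ x) r ^ 2 := by
  have h := sInf_singularValues_sq_mul_norm_sq_le (Matrix.toEuclideanLin G) (WithLp.toLp 2 x) ?_
  · rw [EuclideanSpace.real_norm_sq_eq, EuclideanSpace.real_norm_sq_eq] at h
    exact h
  · intro y hy
    have h1 : G *ᵥ y.ofLp = 0 := congrArg WithLp.ofLp hy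
    rw [← hx _ h1]
    simp [EuclideanSpace.inner_eq_star_dotProduct, dotProduct_comm]

theorem sigmaMin_nonneg (G : Matrix R K ℝ) : 0 ≤ sigmaMin G :=
  LinearMap.singularValues_nonneg _ _

theorem sigmaMinNonzero_nonneg (G : Matrix R K ℝ) : 0 ≤ sigmaMinNonzero G := by
  refine Real.sInf_nonneg ?_
  rintro s ⟨_, i, rfl⟩
  exact LinearMap.singularValues_nonneg _ i

end SigmaMin

/-! ### The equations `A X - Yᵀ B = R` in vectorized form -/

section Vectorized

variable {m p q : ℕ}

theorem sum_sq_vec {ι κ : Type*} [Fintype ι] [Fintype κ] (X : Matrix ι κ ℝ) :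
    ∑ k, X.vec k ^ 2 = frobSq X := by
  rw [Fintype.sum_prod_type, frobSq, Finset.sum_comm]
  rfl

/-- Applied to the stacked vector of `vec X` and `-vec Yᵀ`, the two block rows of `offG` give the
vectorizations of `A X - Yᵀ B` and of `-(B Y - Xᵀ A)ᵀ`. -/
theorem offG_sq_mul_le (A : Fin m → Matrix (Fin p) (Fin p) ℝ)
    (B : Fin m → Matrix (Fin q) (Fin q) ℝ) (X : Matrix (Fin p) (Fin q) ℝ)
    (Y : Matrix (Fin q) (Fin p) ℝ) :
    sigmaMin (offG A B) ^ 2 * (frobSq X + frobSq Y) ≤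
      ∑ i, (frobSq (A i * X - Yᵀ * B i) + frobSq (B i * Y - Xᵀ * A i)) := by
  have h := sigmaMin_sq_mul_le (offG A B) (Sum.elim X.vec (-Yᵀ).vec)
  have hx : ∑ k, (Sum.elim X.vec (-Yᵀ).vec) k ^ 2 = frobSq X + frobSq Y := by
    rw [Fintype.sum_sum_type]
    simp only [Sum.elim_inl, Sum.elim_inr, sum_sq_vec]
    rw [← frobSq_transpose Y]
    simp [frobSq]
  rw [hx, Fintype.sum_prod_type] at h
  refine h.trans (le_of_eq (Finset.sum_congr rfl fun i _ => ?_))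
  have hG : ∀ s, (offG A B *ᵥ Sum.elim X.vec (-Yᵀ).vec) (i, s) =
      Sum.elim (A i * X - Yᵀ * B i).vec (-(B i * Y - Xᵀ * A i)ᵀ).vec s := by
    intro s
    have h1 : (offG A B *ᵥ Sum.elim X.vec (-Yᵀ).vec) (i, s) =
        (Matrix.fromBlocks
          ((1 : Matrix (Fin q) (Fin q) ℝ) ⊗ₖ A i) ((B i)ᵀ ⊗ₖ (1 : Matrix (Fin p) (Fin p) ℝ))
          ((1 : Matrix (Fin q) (Fin q) ℝ) ⊗ₖ (A i)ᵀ) (B i ⊗ₖ (1 : Matrix (Fin p) (Fin p) ℝ))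
          *ᵥ Sum.elim X.vec (-Yᵀ).vec) s := rfl
    rw [h1, Matrix.fromBlocks_mulVec]
    simp only [Sum.elim_comp_inl, Sum.elim_comp_inr, Matrix.kronecker_mulVec_vec,
      ← Matrix.vec_add]
    congr 2
    · simp [sub_eq_add_neg]
    · simp [sub_eq_add_neg]
  rw [Fintype.sum_sum_type]
  simp only [hG, Sum.elim_inl, Sum.elim_inr, sum_sq_vec]
  congr 1
  rw [← frobSq_transpose (B i * Y - Xᵀ * A i)]
  simp only [frobSq, Matrix.neg_apply, neg_sq]

theorem diagG_mulVec (A : Fin m → Matrix (Fin p) (Fin p) ℝ) (Z : Matrix (Fin p) (Fin p) ℝ)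
    (i : Fin m) (s : Fin p × Fin p) :
    (diagG A *ᵥ Z.vec) (i, s) = (A i * Z - Zᵀ * A i).vec s := by
  have h1 : (diagG A *ᵥ Z.vec) (i, s) = (((1 : Matrix (Fin p) (Fin p) ℝ) ⊗ₖ A i
      - ((A i)ᵀ ⊗ₖ (1 : Matrix (Fin p) (Fin p) ℝ)) * shuffle p) *ᵥ Z.vec) s := rfl
  have h2 : shuffle p *ᵥ Z.vec = Zᵀ.vec := by
    ext k
    simp [shuffle, Equiv.Perm.permMatrix, PEquiv.toMatrix_toPEquiv_mulVec, Matrix.vec]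
  rw [h1, Matrix.sub_mulVec, ← Matrix.mulVec_mulVec, h2, Matrix.kronecker_mulVec_vec,
    Matrix.kronecker_mulVec_vec]
  simp

/-- The identity spans the one-dimensional null space. With `z = tr Z / p` the matrix `Z - z I` is
orthogonal to it, and subtracting `z I` leaves the residual unchanged. -/
theorem diagG_sq_mul_le (hp : 0 < p) (A : Fin m → Matrix (Fin p) (Fin p) ℝ)
    (hA : Module.finrank ℝ (nullSpace A) = 1) (Z : Matrix (Fin p) (Fin p) ℝ) :
    ∃ z : ℝ, sigmaMinNonzero (diagG A) ^ 2 * frobSq (Z - z • (1 : Matrix (Fin p) (Fin p) ℝ)) ≤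
      ∑ i, frobSq (A i * Z - Zᵀ * A i) := by
  have hp' : (p : ℝ) ≠ 0 := by exact_mod_cast hp.ne'
  have : NeZero p := ⟨hp.ne'⟩
  refine ⟨Z.trace / p, ?_⟩
  set z := Z.trace / p with hz
  set H := Z - z • (1 : Matrix (Fin p) (Fin p) ℝ) with hH
  have htr : H.trace = 0 := by
    rw [hH, Matrix.trace_sub, Matrix.trace_smul, Matrix.trace_one, hz, Fintype.card_fin,
      smul_eq_mul, div_mul_cancel₀ _ hp', sub_self]
  have h := sigmaMinNonzero_sq_mul_le (diagG A) H.vec ?_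
  · rw [sum_sq_vec, Fintype.sum_prod_type] at h
    refine h.trans (le_of_eq (Finset.sum_congr rfl fun i _ => ?_))
    have e : A i * H - Hᵀ * A i = A i * Z - Zᵀ * A i := by
      rw [hH]
      simp [Matrix.mul_sub, Matrix.sub_mul]
    simp only [diagG_mulVec, e, sum_sq_vec]
  · intro y hy
    obtain ⟨X, rfl⟩ := Matrix.vec_bijective.2 y
    have hX : X ∈ nullSpace A := fun i => by
      rw [← Matrix.vec_eq_zero_iff]
      ext s
      rw [← diagG_mulVec, hy]
      rfl
    have hI : (1 : Matrix (Fin p) (Fin p) ℝ) ∈ nullSpace A := fun i => by simp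
    obtain ⟨r, hr⟩ := (finrank_eq_one_iff_of_nonzero' (⟨1, hI⟩ : nullSpace A)
      (fun h0 => one_ne_zero (congrArg Subtype.val h0))).mp hA ⟨X, hX⟩
    have hr' : r • (1 : Matrix (Fin p) (Fin p) ℝ) = X := congrArg Subtype.val hr
    rw [Matrix.vec_dotProduct_vec, ← hr']
    simp [htr]

end Vectorized

/-! ### The blocks of a composition -/

section CompositionBlocks

variable {m n : ℕ} (c : Composition n)

theorem index_surjective : Function.Surjective c.index := fun j =>
  ⟨c.embedding j ⟨0, c.one_le_blocksFun j⟩, c.index_embedding j _⟩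

theorem sum_eq_sum_blocks {M : Type*} [AddCommMonoid M] (f : Fin n → M) :
    ∑ i, f i = ∑ j, ∑ a, f (c.embedding j a) := by
  rw [← c.blocksFinEquiv.sum_comp, Fintype.sum_sigma]
  rfl

theorem frobSq_eq_sum_block (A : Matrix (Fin n) (Fin n) ℝ) :
    frobSq A = ∑ j, ∑ k, frobSq (block c A j k) := by
  simp only [frobSq]
  rw [sum_eq_sum_blocks c]
  refine Finset.sum_congr rfl fun j _ => ?_
  have h : ∀ a, ∑ x, A (c.embedding j a) x ^ 2 =
      ∑ k, ∑ b, A (c.embedding j a) (c.embedding k b) ^ 2 := fun a => sum_eq_sum_blocks c _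
  simp only [h]
  exact Finset.sum_comm

theorem isBlockDiag_iff {A : Matrix (Fin n) (Fin n) ℝ} :
    IsBlockDiag c A ↔ VanishesOff c.index A := by
  constructor
  · intro h i j hij
    have := congrFun (congrFun (h _ _ hij) (c.invEmbedding i)) (c.invEmbedding j)
    simpa [block] using this
  · intro h j k hjk
    ext a b
    exact h _ _ (by simpa using hjk)

variable {c}

theorem IsBlockDiag.block_mul {B : Matrix (Fin n) (Fin n) ℝ} (hB : IsBlockDiag c B)
    (Z : Matrix (Fin n) (Fin n) ℝ) (j k : Fin c.length) :
    block c (B * Z) j k = block c B j j * block c Z j k := by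
  ext a b
  simp only [block, Matrix.submatrix_apply, Matrix.mul_apply]
  rw [sum_eq_sum_blocks c, Finset.sum_eq_single j]
  · intro l _ hl
    refine Finset.sum_eq_zero fun d _ => ?_
    have : B (c.embedding j a) (c.embedding l d) = 0 := congrFun (congrFun (hB j l hl.symm) a) d
    rw [this, zero_mul]
  · simp

theorem IsBlockDiag.block_mul_right {B : Matrix (Fin n) (Fin n) ℝ} (hB : IsBlockDiag c B)
    (Z : Matrix (Fin n) (Fin n) ℝ) (j k : Fin c.length) :
    block c (Z * B) j k = block c Z j k * block c B k k := by
  ext a b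
  simp only [block, Matrix.submatrix_apply, Matrix.mul_apply]
  rw [sum_eq_sum_blocks c, Finset.sum_eq_single k]
  · intro l _ hl
    refine Finset.sum_eq_zero fun d _ => ?_
    have : B (c.embedding l d) (c.embedding k b) = 0 := congrFun (congrFun (hB l k hl) d) b
    rw [this, mul_zero]
  · simp

theorem block_transpose (Z : Matrix (Fin n) (Fin n) ℝ) (j k : Fin c.length) :
    (block c Z j k)ᵀ = block c Zᵀ k j := rfl

theorem block_sub (A B : Matrix (Fin n) (Fin n) ℝ) (j k : Fin c.length) :
    block c (A - B) j k = block c A j k - block c B j k := rfl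

theorem frobSq_offPart_eq (Z : Matrix (Fin n) (Fin n) ℝ) :
    frobSq (offPart c.index Z) = ∑ j, ∑ k, if j = k then 0 else frobSq (block c Z j k) := by
  rw [frobSq_eq_sum_block c]
  refine Finset.sum_congr rfl fun j _ => Finset.sum_congr rfl fun k _ => ?_
  split_ifs with h <;> simp [frobSq, block, offPart, h]

/-- Translates the diagonal hypothesis of `exists_blockDiag_mul_perm_near` into a statement about
one block. -/
theorem frobSq_indicator_mul_onPart (Z : Matrix (Fin n) (Fin n) ℝ) (z : ℝ) (j : Fin c.length) :
    frobSq (Matrix.diagonal (fun i => if c.index i = j then (1 : ℝ) else 0) *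
      (onPart c.index Z - z • (1 : Matrix (Fin n) (Fin n) ℝ))) =
    frobSq (block c Z j j - z • (1 : Matrix _ _ ℝ)) := by
  rw [frobSq_eq_sum_block c, Finset.sum_eq_single j, Finset.sum_eq_single j]
  · congr 1
    ext a b
    simp [block, onPart, Matrix.one_apply]
  · intro k _ hk
    have hne : ∀ a b, c.embedding j a ≠ c.embedding k b := fun a b h => hk (by
      rw [← c.index_embedding k b, ← h, c.index_embedding])
    simp [frobSq, block, onPart, hk.symm, hne]
  · simp
  · intro k _ hk
    refine Finset.sum_eq_zero fun l _ => ?_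
    simp [frobSq, block, hk]
  · simp

theorem frobSq_block_le (Z : Matrix (Fin n) (Fin n) ℝ) (j k : Fin c.length) :
    frobSq (block c Z j k) ≤ frobSq Z := by
  rw [frobSq_eq_sum_block c]
  exact (Finset.single_le_sum (f := fun k => frobSq (block c Z j k))
    (fun _ _ => frobSq_nonneg _) (Finset.mem_univ k)).trans
    (Finset.single_le_sum (f := fun j => ∑ k, frobSq (block c Z j k))
      (fun _ _ => Finset.sum_nonneg fun _ _ => frobSq_nonneg _) (Finset.mem_univ j))

theorem omegaUq_le (A : Fin m → Matrix (Fin n) (Fin n) ℝ) (W : Matrix (Fin n) (Fin n) ℝ)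
    {j k : Fin c.length} (h : j < k) :
    omegaUq c A W ≤ sigmaMin (offG (diagBlocks c A W j) (diagBlocks c A W k)) :=
  ciInf_le (Set.finite_range _).bddBelow
    (⟨(j, k), h⟩ : {p : Fin c.length × Fin c.length // p.1 < p.2})

theorem omegaUq_nonneg (A : Fin m → Matrix (Fin n) (Fin n) ℝ) (W : Matrix (Fin n) (Fin n) ℝ) :
    0 ≤ omegaUq c A W :=
  Real.iInf_nonneg fun _ => sigmaMin_nonneg _

/-- The off-diagonal blocks of an approximate solution `Z` of the equations `B Z = Zᵀ B`. -/
theorem omegaUq_sq_mul_frobSq_offPart_le {A : Fin m → Matrix (Fin n) (Fin n) ℝ}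
    {W : Matrix (Fin n) (Fin n) ℝ} (hW : ∀ i, IsBlockDiag c (Wᵀ * A i * W))
    (Z : Matrix (Fin n) (Fin n) ℝ) :
    omegaUq c A W ^ 2 * frobSq (offPart c.index Z) ≤
      ∑ i, frobSq (Wᵀ * A i * W * Z - Zᵀ * (Wᵀ * A i * W)) := by
  set R : Fin m → Matrix (Fin n) (Fin n) ℝ :=
    fun i => Wᵀ * A i * W * Z - Zᵀ * (Wᵀ * A i * W) with hR
  -- Blocks `(j,k)` and `(k,j)` of the residual involve only the same two blocks of `Z`, which
  -- decouples the system into the `G_jk`.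
  have hblock : ∀ i j k, block c (R i) j k = diagBlocks c A W j i * block c Z j k
      - (block c Z k j)ᵀ * diagBlocks c A W k i := fun i j k => by
    rw [hR, block_sub, (hW i).block_mul, (hW i).block_mul_right, block_transpose]
    rfl
  have hlt : ∀ j k : Fin c.length, j < k →
      omegaUq c A W ^ 2 * (frobSq (block c Z j k) + frobSq (block c Z k j)) ≤
        ∑ i, frobSq (block c (R i) j k) + ∑ i, frobSq (block c (R i) k j) := by
    intro j k hjk
    have h := offG_sq_mul_le (diagBlocks c A W j) (diagBlocks c A W k) (block c Z j k)
      (block c Z k j)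
    simp only [← hblock] at h
    rw [← Finset.sum_add_distrib]
    refine le_trans (mul_le_mul_of_nonneg_right ?_
      (add_nonneg (frobSq_nonneg _) (frobSq_nonneg _))) h
    exact pow_le_pow_left₀ (omegaUq_nonneg A W) (omegaUq_le A W hjk) 2
  have hne : ∀ j k : Fin c.length, j ≠ k →
      omegaUq c A W ^ 2 * (frobSq (block c Z j k) + frobSq (block c Z k j)) ≤
        ∑ i, frobSq (block c (R i) j k) + ∑ i, frobSq (block c (R i) k j) := by
    intro j k hjk
    rcases lt_or_gt_of_ne hjk with h | h
    · exact hlt j k h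
    · rw [add_comm (frobSq (block c Z j k)), add_comm (∑ i, frobSq (block c (R i) j k))]
      exact hlt k j h
  have hsym : ∀ f : Fin c.length → Fin c.length → ℝ,
      ∑ j, ∑ k, (f j k + f k j) = 2 * ∑ j, ∑ k, f j k := fun f => by
    simp only [Finset.sum_add_distrib]
    rw [Finset.sum_comm (f := fun j k => f k j)]
    ring
  have hsum : ∑ i, frobSq (R i) = ∑ j, ∑ k, ∑ i, frobSq (block c (R i) j k) := by
    simp only [frobSq_eq_sum_block c (R _)]
    rw [Finset.sum_comm]
    exact Finset.sum_congr rfl fun j _ => Finset.sum_comm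
  -- Summing over ordered pairs counts every pair `j < k` twice, whence the factor `2` on both
  -- sides.
  have h2 : 2 * (omegaUq c A W ^ 2 * frobSq (offPart c.index Z)) ≤ 2 * ∑ i, frobSq (R i) := by
    rw [frobSq_offPart_eq, hsum, mul_left_comm, ← hsym, ← hsym, Finset.mul_sum]
    refine Finset.sum_le_sum fun j _ => ?_
    rw [Finset.mul_sum]
    refine Finset.sum_le_sum fun k _ => ?_
    by_cases h : j = k
    · rw [if_pos h, if_pos h.symm, add_zero, mul_zero]
      exact add_nonneg (Finset.sum_nonneg fun _ _ => frobSq_nonneg _)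
        (Finset.sum_nonneg fun _ _ => frobSq_nonneg _)
    · rw [if_neg h, if_neg (Ne.symm h)]
      exact hne j k h
  linarith

/-- The diagonal blocks of an approximate solution `Z` of the equations `B Z = Zᵀ B`. -/
theorem sigmaMinNonzero_sq_mul_frobSq_diag_le {A : Fin m → Matrix (Fin n) (Fin n) ℝ}
    {W : Matrix (Fin n) (Fin n) ℝ} (hW : ∀ i, IsBlockDiag c (Wᵀ * A i * W)) (j : Fin c.length)
    (hj : Module.finrank ℝ (nullSpace (diagBlocks c A W j)) = 1) (Z : Matrix (Fin n) (Fin n) ℝ) :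
    ∃ z : ℝ, sigmaMinNonzero (diagG (diagBlocks c A W j)) ^ 2 *
        frobSq (block c Z j j - z • (1 : Matrix _ _ ℝ)) ≤
      ∑ i, frobSq (Wᵀ * A i * W * Z - Zᵀ * (Wᵀ * A i * W)) := by
  obtain ⟨z, hz⟩ := diagG_sq_mul_le (c.one_le_blocksFun j) _ hj (block c Z j j)
  refine ⟨z, hz.trans (Finset.sum_le_sum fun i _ => ?_)⟩
  refine le_trans (le_of_eq ?_) (frobSq_block_le (c := c) _ j j)
  rw [block_sub, (hW i).block_mul, (hW i).block_mul_right, block_transpose]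
  rfl

end CompositionBlocks

/-! ### Norms -/

section Norms

variable {m n : ℕ}

theorem frobNorm_sq (A : Matrix (Fin n) (Fin n) ℝ) : frobNorm A ^ 2 = frobSq A :=
  Real.sq_sqrt (frobSq_nonneg A)

theorem frobNorm_eq (A : Matrix (Fin n) (Fin n) ℝ) : frobNorm A = √(frobSq A) := rfl

theorem famNorm_eq (A : Fin m → Matrix (Fin n) (Fin n) ℝ) :
    famNorm A = √(∑ i, frobSq (A i)) := by
  simp only [famNorm, frobNorm_sq]

theorem famNorm_nonneg (A : Fin m → Matrix (Fin n) (Fin n) ℝ) : 0 ≤ famNorm A :=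
  Real.sqrt_nonneg _

theorem famNorm_sq (A : Fin m → Matrix (Fin n) (Fin n) ℝ) :
    famNorm A ^ 2 = ∑ i, frobSq (A i) := by
  rw [famNorm_eq, Real.sq_sqrt (Finset.sum_nonneg fun _ _ => frobSq_nonneg _)]

theorem famNorm_mono {A B : Fin m → Matrix (Fin n) (Fin n) ℝ}
    (h : ∀ i, frobSq (A i) ≤ frobSq (B i)) : famNorm A ≤ famNorm B := by
  rw [famNorm_eq, famNorm_eq]
  exact Real.sqrt_le_sqrt (Finset.sum_le_sum fun i _ => h i)

theorem famNorm_add_le (A B : Fin m → Matrix (Fin n) (Fin n) ℝ) :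
    famNorm (fun i => A i + B i) ≤ famNorm A + famNorm B := by
  have h : ∀ X : Fin m → Matrix (Fin n) (Fin n) ℝ, famNorm X =
      ‖(WithLp.toLp 2 fun k : Fin m × Fin n × Fin n => X k.1 k.2.1 k.2.2 :
        EuclideanSpace ℝ (Fin m × Fin n × Fin n))‖ := fun X => by
    rw [famNorm_eq, EuclideanSpace.norm_eq]
    simp only [Real.norm_eq_abs, sq_abs, Fintype.sum_prod_type, frobSq]
  rw [h A, h B, h fun i => A i + B i]
  refine le_trans (le_of_eq (congrArg norm ?_)) (norm_add_le _ _)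
  ext k
  simp

theorem frobSq_mul_diagonal_le (A : Matrix (Fin n) (Fin n) ℝ) {d : Fin n → ℝ}
    (hd : ∀ i, |d i| ≤ 1) : frobSq (A * Matrix.diagonal d) ≤ frobSq A := by
  refine Finset.sum_le_sum fun i _ => Finset.sum_le_sum fun j _ => ?_
  rw [Matrix.mul_diagonal, mul_pow]
  exact mul_le_of_le_one_right (sq_nonneg _) ((sq_le_one_iff_abs_le_one _).mpr (hd j))

theorem specNorm_le_frobNorm (A : Matrix (Fin n) (Fin n) ℝ) : specNorm A ≤ frobNorm A := by
  refine ContinuousLinearMap.opNorm_le_bound _ (Real.sqrt_nonneg _) fun x => ?_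
  refine le_of_sq_le_sq ?_ (mul_nonneg (Real.sqrt_nonneg _) (norm_nonneg _))
  have h := sum_sq_mulVec_le A x.ofLp
  have h2 : √(frobSq A) ^ 2 = frobSq A := Real.sq_sqrt (frobSq_nonneg A)
  rw [mul_pow, frobNorm_eq, h2, EuclideanSpace.real_norm_sq_eq, EuclideanSpace.real_norm_sq_eq]
  exact h

/-- Unitaries of a nontrivial C*-algebra have norm `1`; for `n = 0` the norm would be `0`. -/
theorem specNorm_orthogonal (hn : 0 < n) {U : Matrix (Fin n) (Fin n) ℝ}
    (hU : U ∈ Matrix.orthogonalGroup (Fin n) ℝ) : specNorm U = 1 := by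
  have : Nonempty (Fin n) := ⟨⟨0, hn⟩⟩
  have h : Matrix.toEuclideanCLM (n := Fin n) (𝕜 := ℝ) U ∈
      unitary (EuclideanSpace ℝ (Fin n) →L[ℝ] EuclideanSpace ℝ (Fin n)) :=
    Unitary.map_mem _ hU
  exact CStarRing.norm_of_mem_unitary h

theorem continuous_specNorm : Continuous (specNorm (n := n)) :=
  continuous_norm.comp (LinearMap.continuous_of_finiteDimensional
    (Matrix.toEuclideanCLM (n := Fin n) (𝕜 := ℝ)).toAlgEquiv.toLinearMap)

theorem continuous_frobNorm : Continuous (frobNorm (n := n)) := by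
  unfold frobNorm
  fun_prop

end Norms

/-! ### The perturbation bound for orthogonal diagonalizers -/

section Orthogonal

variable {m n : ℕ} {c : Composition n}

theorem inv_eq_transpose_of_orthogonal {U : Matrix (Fin n) (Fin n) ℝ}
    (hU : U ∈ Matrix.orthogonalGroup (Fin n) ℝ) : U⁻¹ = Uᵀ :=
  Matrix.inv_eq_left_inv ((Matrix.mem_orthogonalGroup_iff' _ _).mp hU)

theorem inv_mul_mem_orthogonalGroup {W W' : Matrix (Fin n) (Fin n) ℝ}
    (hW : W ∈ Matrix.orthogonalGroup (Fin n) ℝ) (hW' : W' ∈ Matrix.orthogonalGroup (Fin n) ℝ) :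
    W⁻¹ * W' ∈ Matrix.orthogonalGroup (Fin n) ℝ := by
  rw [inv_eq_transpose_of_orthogonal hW]
  exact mul_mem (Unitary.star_mem hW) hW'

theorem delta_eq_of_orthogonal (hn : 0 < n) (γ : Fin c.length → ℝ)
    (A A' : Fin m → Matrix (Fin n) (Fin n) ℝ) {W W' : Matrix (Fin n) (Fin n) ℝ}
    (hW : W ∈ Matrix.orthogonalGroup (Fin n) ℝ) (hW' : W' ∈ Matrix.orthogonalGroup (Fin n) ℝ) :
    delta c γ A A' W W' = rTilde c γ A' W' + 2 * deltaA A A' := by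
  have hQ := inv_mul_mem_orthogonalGroup hW hW'
  have hQi : specNorm (W⁻¹ * W')⁻¹ = 1 := by
    rw [inv_eq_transpose_of_orthogonal hQ]
    exact specNorm_orthogonal hn (Unitary.star_mem hQ)
  rw [delta, hQi, specNorm_orthogonal hn hW, specNorm_orthogonal hn hW']
  ring

theorem cond₂_eq_one_of_orthogonal (hn : 0 < n) {Q : Matrix (Fin n) (Fin n) ℝ}
    (hQ : Q ∈ Matrix.orthogonalGroup (Fin n) ℝ) : cond₂ Q = 1 := by
  rw [cond₂, inv_eq_transpose_of_orthogonal hQ, specNorm_orthogonal hn hQ, one_mul]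
  exact specNorm_orthogonal hn (Unitary.star_mem hQ)

/-- The residual of `Z = Q Γ Qᵀ`, with `Q = Wᵀ W'`, in the equations `B Z = Zᵀ B`. -/
theorem sum_frobSq_residual_le (γ : Fin c.length → ℝ) (hγ : ∀ j, |γ j| ≤ 1)
    (A A' : Fin m → Matrix (Fin n) (Fin n) ℝ) {W W' : Matrix (Fin n) (Fin n) ℝ}
    (hW : W * Wᵀ = 1) (hW' : W'ᵀ * W' = 1) {Z : Matrix (Fin n) (Fin n) ℝ}
    (hZ : Z = Wᵀ * W' * gammaMat c γ * (Wᵀ * W')ᵀ) :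
    ∑ i, frobSq (Wᵀ * A i * W * Z - Zᵀ * (Wᵀ * A i * W)) ≤
      (rTilde c γ A' W' + 2 * deltaA A A') ^ 2 := by
  set Γ := gammaMat c γ with hΓ
  set Q := Wᵀ * W' with hQ
  have hQQ : Qᵀ * Q = 1 := by
    rw [hQ, Matrix.transpose_mul, Matrix.transpose_transpose, Matrix.mul_assoc,
      ← Matrix.mul_assoc W, hW, Matrix.one_mul, hW']
  have hQQ' : Q * Qᵀ = 1 := mul_eq_one_comm.mp hQQ
  have hQQt : Qᵀ * Qᵀᵀ = 1 := by rwa [Matrix.transpose_transpose]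
  have hZs : Zᵀ = Z := by
    rw [hZ]
    simp [Matrix.transpose_mul, Matrix.mul_assoc, hΓ, gammaMat]
  let Δ : Fin m → Matrix (Fin n) (Fin n) ℝ := fun i => Wᵀ * (A' i - A i) * W
  have hΔ : ∀ i, frobSq (Δ i) = frobSq (A' i - A i) := fun i => by
    rw [frobSq_mul_orthogonal hW, frobSq_orthogonal_mul]
    rwa [Matrix.transpose_transpose]
  -- Since `|γ_j| ≤ 1`, multiplication by `Z` is nonexpansive; each of the two terms in `Δ` then
  -- costs one `δ_𝒜`.
  have hmulZ : ∀ X, frobSq (X * Z) ≤ frobSq X := fun X => by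
    rw [hZ, ← Matrix.mul_assoc, frobSq_mul_orthogonal hQQt, ← Matrix.mul_assoc]
    refine (frobSq_mul_diagonal_le _ fun i => hγ _).trans (le_of_eq ?_)
    exact frobSq_mul_orthogonal hQQ' X
  have hZmul : ∀ X, frobSq (Z * X) ≤ frobSq X := fun X => by
    rw [← frobSq_transpose, Matrix.transpose_mul, hZs, ← frobSq_transpose X]
    exact hmulZ _
  have hsplit : ∀ i, Wᵀ * A i * W * Z - Zᵀ * (Wᵀ * A i * W) =
      Q * residual c γ A' W' i * Qᵀ + (-(Δ i * Z) + Z * Δ i) := fun i => by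
    have hA' : Q * (W'ᵀ * A' i * W') * Qᵀ = Wᵀ * A' i * W := by
      have hWW : W' * W'ᵀ = 1 := mul_eq_one_comm.mp hW'
      calc Q * (W'ᵀ * A' i * W') * Qᵀ = Wᵀ * (W' * W'ᵀ) * A' i * (W' * W'ᵀ) * W := by
            simp only [hQ, Matrix.transpose_mul, Matrix.transpose_transpose, Matrix.mul_assoc]
        _ = _ := by rw [hWW, Matrix.mul_one, Matrix.mul_one]
    have h1 : Q * (W'ᵀ * A' i * W' * Γ) * Qᵀ = Wᵀ * A' i * W * Z := by
      rw [← hA', hZ]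
      calc _ = Q * (W'ᵀ * A' i * W') * 1 * Γ * Qᵀ := by
            simp only [Matrix.mul_assoc, Matrix.one_mul]
        _ = _ := by simp only [← hQQ, Matrix.mul_assoc]
    have h2 : Q * (Γ * (W'ᵀ * A' i * W')) * Qᵀ = Z * (Wᵀ * A' i * W) := by
      rw [← hA', hZ]
      calc _ = Q * Γ * 1 * (W'ᵀ * A' i * W') * Qᵀ := by
            simp only [Matrix.mul_assoc, Matrix.one_mul]
        _ = _ := by simp only [← hQQ, Matrix.mul_assoc]
    rw [residual, Matrix.mul_sub, Matrix.sub_mul, h1, h2, hZs]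
    simp only [Δ, Matrix.mul_sub, Matrix.sub_mul]
    abel
  have hneg : ∀ X : Matrix (Fin n) (Fin n) ℝ, frobSq (-X) = frobSq X := fun X => by
    simp [frobSq]
  have hfam : famNorm (fun i => Wᵀ * A i * W * Z - Zᵀ * (Wᵀ * A i * W)) ≤
      rTilde c γ A' W' + 2 * deltaA A A' := by
    simp only [hsplit]
    refine (famNorm_add_le _ _).trans ?_
    refine add_le_add (famNorm_mono fun i => ?_) ?_
    · rw [frobSq_mul_orthogonal hQQt, frobSq_orthogonal_mul hQQ]
    · rw [two_mul]
      refine (famNorm_add_le _ _).trans (add_le_add ?_ ?_)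
      · exact famNorm_mono fun i => by
          rw [hneg]
          exact (hmulZ _).trans (hΔ i).le
      · exact famNorm_mono fun i => (hZmul _).trans (hΔ i).le
  rw [← famNorm_sq]
  exact pow_le_pow_left₀ (famNorm_nonneg _) hfam 2

end Orthogonal

/-! ### Attainment of the minimum -/

section Attained

variable {n : ℕ} (c : Composition n)

theorem isCompact_blockDiag_orthogonal :
    IsCompact {D : Matrix (Fin n) (Fin n) ℝ | IsBlockDiag c D ∧ Dᵀ * D = 1} := by
  have hK : IsCompact {D : Matrix (Fin n) (Fin n) ℝ | ∀ i j, D i j ∈ Set.Icc (-1 : ℝ) 1} := by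
    have := isCompact_univ_pi fun _ : Fin n => isCompact_univ_pi fun _ : Fin n =>
      isCompact_Icc (a := (-1 : ℝ)) (b := 1)
    refine this.of_isClosed_subset ?_ fun D hD i _ j _ => hD i j
    simp only [Set.ofPred_forall]
    exact isClosed_iInter fun i => isClosed_iInter fun j =>
      isClosed_Icc.preimage (continuous_id.matrix_elem i j)
  refine hK.of_isClosed_subset ?_ ?_
  · have h1 : IsClosed {D : Matrix (Fin n) (Fin n) ℝ | IsBlockDiag c D} := by
      simp only [isBlockDiag_iff, VanishesOff, Set.ofPred_forall]
      exact isClosed_iInter fun i => isClosed_iInter fun j => isClosed_iInter fun _ =>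
        isClosed_eq (continuous_id.matrix_elem i j) continuous_const
    exact h1.inter (isClosed_eq (by fun_prop) continuous_const)
  · rintro D ⟨_, hD⟩ i j
    have h := congrFun (congrFun hD j) j
    rw [Matrix.one_apply_eq, Matrix.mul_apply] at h
    simp only [Matrix.transpose_apply, ← sq] at h
    have h2 : D i j ^ 2 ≤ 1 := h ▸ Finset.single_le_sum (f := fun k => D k j ^ 2)
      (fun _ _ => sq_nonneg _) (Finset.mem_univ i)
    exact abs_le.mp ((sq_le_one_iff_abs_le_one _).mp h2)

theorem finite_isBlockPreservingPerm :
    {P : Matrix (Fin n) (Fin n) ℝ | IsBlockPreservingPerm c P}.Finite := by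
  refine (Set.finite_range fun σ : Equiv.Perm (Fin n) => σ.permMatrix ℝ).subset ?_
  rintro P ⟨⟨σ, rfl⟩, _⟩
  exact ⟨σ, rfl⟩

/-- The values form the continuous image of a compact set times a finite set. -/
theorem exists_isLeast_relErrors {nrm : Matrix (Fin n) (Fin n) ℝ → ℝ} (hnrm : Continuous nrm)
    (W W' : Matrix (Fin n) (Fin n) ℝ) (hne : (relErrors c nrm W W').Nonempty) :
    ∃ e, IsLeast (relErrors c nrm W W') e := by
  have himg : relErrors c nrm W W' =
      (fun x : Matrix (Fin n) (Fin n) ℝ × Matrix (Fin n) (Fin n) ℝ =>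
        nrm (W - W' * x.1 * x.2) / nrm W') ''
        ({D | IsBlockDiag c D ∧ Dᵀ * D = 1} ×ˢ {P | IsBlockPreservingPerm c P}) := by
    ext e
    constructor
    · rintro ⟨D, P, hD, hD', hP, rfl⟩
      exact ⟨(D, P), ⟨⟨hD, hD'⟩, hP⟩, rfl⟩
    · rintro ⟨⟨D, P⟩, ⟨⟨hD, hD'⟩, hP⟩, rfl⟩
      exact ⟨D, P, hD, hD', hP, rfl⟩
  refine IsCompact.exists_isLeast ?_ hne
  rw [himg]
  refine ((isCompact_blockDiag_orthogonal c).prod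
    (finite_isBlockPreservingPerm c).isCompact).image ?_
  exact (hnrm.comp (by fun_prop)).div_const _

theorem isBlockPreservingPerm_permMatrix {σ : Equiv.Perm (Fin n)}
    (hσ : ∀ i j, c.index (σ i) = c.index (σ j) ↔ c.index i = c.index j) :
    IsBlockPreservingPerm c (σ.permMatrix ℝ) := by
  refine ⟨⟨σ, rfl⟩, fun D hD => ?_⟩
  rw [isBlockDiag_iff] at hD ⊢
  intro i j hij
  rw [mul_permMatrix_apply, permMatrix_transpose_mul_apply]
  refine hD _ _ fun h => hij ?_
  have := (hσ (σ.symm i) (σ.symm j)).mpr h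
  simpa using this

end Attained

/-! ### The constants -/

section Constants

variable {t : ℕ}

theorem tauC_pos (ht : 2 ≤ t) : 0 < tauC t := by
  have h2 : (2 : ℝ) ≤ t := by exact_mod_cast ht
  have h : (1 : ℝ) < √2 := Real.lt_sqrt_of_sq_lt (by norm_num)
  exact div_pos (by linarith) (Real.sqrt_pos.mpr (by linarith))

theorem alphaC_pos (ht : 2 ≤ t) : 0 < alphaC t := by
  have := tauC_pos ht
  unfold alphaC
  positivity

/-- By AM-GM `(√2 + τ)² ≥ 4√2 τ`, so `α ≤ 1 / (2√2) < 2/5`. Being below `1/2` keeps `1 - 2ε`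
positive. -/
theorem alphaC_lt (ht : 2 ≤ t) : alphaC t < 2 / 5 := by
  have hτ := tauC_pos ht
  have h : (7 / 5 : ℝ) < √2 := Real.lt_sqrt_of_sq_lt (by norm_num)
  unfold alphaC
  rw [div_lt_div_iff₀ (by positivity) (by norm_num)]
  nlinarith [sq_nonneg (√2 - tauC t), mul_pos (sub_pos.mpr h) hτ]

/-- Here `τ / α = (√2 + τ)² / 2 ≥ 1` and `√t ≥ √2`, so the argument's own constant `√2` fits under
the claimed one. -/
theorem sqrt_two_le_leading_constant (ht : 2 ≤ t) :
    √2 ≤ tauC t / alphaC t * (√(t : ℝ) + √((t : ℝ) - 1)) := by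
  have hτ := tauC_pos ht
  have h2 : (2 : ℝ) ≤ t := by exact_mod_cast ht
  have h : (7 / 5 : ℝ) < √2 := Real.lt_sqrt_of_sq_lt (by norm_num)
  have hs : √2 ^ 2 = 2 := Real.sq_sqrt (by norm_num)
  have h1 : 1 ≤ tauC t / alphaC t := by
    rw [one_le_div (alphaC_pos ht), alphaC, div_le_iff₀ (by positivity)]
    nlinarith [mul_pos hτ hτ, mul_pos (mul_pos hτ hτ) hτ]
  have h3 : √2 ≤ √(t : ℝ) + √((t : ℝ) - 1) :=
    (Real.sqrt_le_sqrt h2).trans (le_add_of_nonneg_right (Real.sqrt_nonneg _))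
  calc √2 = 1 * √2 := (one_mul _).symm
    _ ≤ _ := mul_le_mul h1 h3 (Real.sqrt_nonneg _) (by linarith)

theorem gap_le (γ : Fin t → ℝ) {j k : Fin t} (h : j ≠ k) : gap γ ≤ |γ j - γ k| :=
  ciInf_le (Set.finite_range _).bddBelow (⟨(j, k), h⟩ : {p : Fin t × Fin t // p.1 ≠ p.2})

theorem gap_pos (ht : 2 ≤ t) {γ : Fin t → ℝ} (hγ : Function.Injective γ) : 0 < gap γ := by
  have : Nonempty {p : Fin t × Fin t // p.1 ≠ p.2} :=
    ⟨⟨(⟨0, by omega⟩, ⟨1, by omega⟩), by simp⟩⟩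
  obtain ⟨p, hp⟩ := exists_eq_ciInf_of_finite
    (f := fun p : {p : Fin t × Fin t // p.1 ≠ p.2} => |γ p.1.1 - γ p.1.2|)
  rw [gap, ← hp]
  exact abs_pos.mpr (sub_ne_zero.mpr fun h => p.2 (hγ h))

end Constants

/-! ### From the smallness condition to the Frobenius bound. -/

section Bound

variable {m n : ℕ} {c : Composition n}

/-- The two inequalities behind the smallness condition, for orthogonal diagonalizers. -/
theorem IsSmall.bounds (ht : 2 ≤ c.length) {γ : Fin c.length → ℝ} (hγ : Function.Injective γ)
    {A A' : Fin m → Matrix (Fin n) (Fin n) ℝ} {W W' : Matrix (Fin n) (Fin n) ℝ}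
    (hc : cond₂ (W⁻¹ * W') = 1) (h : IsSmall c γ A A' W W') :
    delta c γ A A' W W' < alphaC c.length * gap γ * omegaUq c A W ∧
      ∀ j, 1 < c.blocksFun j → delta c γ A A' W W' <
        (1 - 2 * alphaC c.length) * gap γ / √2 *
          sigmaMinNonzero (diagG (diagBlocks c A W j)) := by
  rw [IsSmall, hc, div_one, lt_min_iff] at h
  refine ⟨EReal.coe_lt_coe_iff.mp h.1, fun j hj => ?_⟩
  have hpos : 0 ≤ (1 - 2 * alphaC c.length) * gap γ / √2 := by
    have := gap_pos ht hγ
    have := alphaC_lt ht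
    exact div_nonneg (mul_nonneg (by linarith) (by linarith)) (Real.sqrt_nonneg _)
  rw [← EReal.coe_lt_coe_iff, EReal.coe_mul]
  refine h.2.trans_le (mul_le_mul_of_nonneg_left ?_ (EReal.coe_nonneg.mpr hpos))
  exact iInf_le (fun j : {j : Fin c.length // 1 < c.blocksFun j} =>
    ((sigmaMinNonzero (diagG (diagBlocks c A W j.1)) : ℝ) : EReal)) ⟨j, hj⟩

/-- The Frobenius norm bound, with the relative perturbation `ε = δ / (g ω)`. -/
theorem exists_near_of_isSmall (ht : 2 ≤ c.length) {γ : Fin c.length → ℝ}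
    (hγ : Function.Injective γ) (hγ1 : ∀ j, |γ j| ≤ 1)
    {A A' : Fin m → Matrix (Fin n) (Fin n) ℝ} {W W' : Matrix (Fin n) (Fin n) ℝ}
    (hWb : ∀ i, IsBlockDiag c (Wᵀ * A i * W))
    (hnull : ∀ j, Module.finrank ℝ (nullSpace (diagBlocks c A W j)) = 1)
    (hW : W ∈ Matrix.orthogonalGroup (Fin n) ℝ) (hW' : W' ∈ Matrix.orthogonalGroup (Fin n) ℝ)
    (h : IsSmall c γ A A' W W') {ε : ℝ}
    (hε : ε = delta c γ A A' W W' / (gap γ * omegaUq c A W)) :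
    0 ≤ ε ∧ ε < 2 / 5 ∧ ∃ D P : Matrix (Fin n) (Fin n) ℝ, IsBlockDiag c D ∧ Dᵀ * D = 1 ∧
      IsBlockPreservingPerm c P ∧ (1 - ε) ^ 2 * frobSq (W - W' * D * P) ≤ 2 * ε ^ 2 := by
  have hn : 0 < n := c.length_pos_iff.mp (by omega)
  have hδe := delta_eq_of_orthogonal (c := c) hn γ A A' hW hW'
  have hcond := cond₂_eq_one_of_orthogonal hn (inv_mul_mem_orthogonalGroup hW hW')
  obtain ⟨hδ1, hδ2⟩ := h.bounds ht hγ hcond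
  set δ := delta c γ A A' W W' with hδ
  set ω := omegaUq c A W with hω
  set g := gap γ with hg
  set α := alphaC c.length with hα
  have hg0 : 0 < g := gap_pos ht hγ
  have hα0 : 0 < α := alphaC_pos ht
  have hα1 : α < 2 / 5 := alphaC_lt ht
  have hδ0 : 0 ≤ δ := by
    rw [hδe]
    exact add_nonneg (famNorm_nonneg _) (mul_nonneg zero_le_two (famNorm_nonneg _))
  -- Positivity of `ω_uq` is forced by `0 ≤ δ < α g ω_uq`.
  have hω0 : 0 < ω := by
    by_contra hcon
    have : α * g * ω ≤ 0 := mul_nonpos_of_nonneg_of_nonpos (by positivity) (not_lt.mp hcon)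
    linarith
  have hε0 : 0 ≤ ε := hε ▸ by positivity
  have hεα : ε < α := by
    rw [hε, div_lt_iff₀ (by positivity)]
    linarith
  have hεδ : ε * g * ω = δ := by
    rw [hε]
    field_simp
  have hWo : W * Wᵀ = 1 := (Matrix.mem_orthogonalGroup_iff _ _).mp hW
  have hW'o : W'ᵀ * W' = 1 := (Matrix.mem_orthogonalGroup_iff' _ _).mp hW'
  set Q := Wᵀ * W' with hQ
  have hQo : Q * Qᵀ = 1 := by
    rw [hQ, Matrix.transpose_mul, Matrix.transpose_transpose, Matrix.mul_assoc,
      ← Matrix.mul_assoc W', mul_eq_one_comm.mp hW'o, Matrix.one_mul, mul_eq_one_comm.mp hWo]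
  set Z := Q * gammaMat c γ * Qᵀ with hZ
  have hR := sum_frobSq_residual_le γ hγ1 A A' hWo hW'o hZ
  rw [← hδe] at hR
  have hoff : frobSq (offPart c.index Z) ≤ (ε * g) ^ 2 := by
    have h1 := (omegaUq_sq_mul_frobSq_offPart_le hWb Z).trans hR
    rw [← hεδ, mul_pow _ ω, mul_comm _ (ω ^ 2)] at h1
    exact le_of_mul_le_mul_left h1 (pow_pos hω0 2)
  have hdiag : ∀ j, ∃ z : ℝ, 2 * frobSq (Matrix.diagonal
      (fun i => if c.index i = j then (1 : ℝ) else 0) *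
      (onPart c.index Z - z • (1 : Matrix (Fin n) (Fin n) ℝ))) < ((1 - 2 * ε) * g) ^ 2 := by
    intro j
    simp only [frobSq_indicator_mul_onPart]
    have hpos : 0 < (1 - 2 * ε) * g := mul_pos (by linarith) hg0
    -- A block of order one is already scalar, so it needs no bound; this matches its exclusion from
    -- `omegaNd`.
    rcases (c.one_le_blocksFun j).eq_or_lt with h1 | h1
    · have hsub : Subsingleton (Fin (c.blocksFun j)) := Fin.subsingleton_iff_le_one.mpr h1.ge
      refine ⟨Z (c.embedding j ⟨0, h1.le⟩) (c.embedding j ⟨0, h1.le⟩), ?_⟩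
      have h0 : block c Z j j - Z (c.embedding j ⟨0, h1.le⟩) (c.embedding j ⟨0, h1.le⟩) •
          (1 : Matrix (Fin (c.blocksFun j)) (Fin (c.blocksFun j)) ℝ) = 0 := by
        ext a b
        rw [Subsingleton.elim a ⟨0, h1.le⟩, Subsingleton.elim b ⟨0, h1.le⟩]
        simp [block]
      rw [h0]
      have : frobSq (0 : Matrix (Fin (c.blocksFun j)) (Fin (c.blocksFun j)) ℝ) = 0 := by
        simp [frobSq]
      rw [this, mul_zero]
      positivity
    · obtain ⟨z, hz⟩ := sigmaMinNonzero_sq_mul_frobSq_diag_le hWb j (hnull j) Z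
      refine ⟨z, ?_⟩
      have h2 := hδ2 j h1
      set s := sigmaMinNonzero (diagG (diagBlocks c A W j)) with hs
      have hs0 : 0 ≤ s := sigmaMinNonzero_nonneg _
      have hs1 : 0 < s := by
        refine hs0.lt_of_ne fun h0 => ?_
        rw [← h0, mul_zero] at h2
        linarith
      have h3 : δ ^ 2 < ((1 - 2 * α) * g / √2 * s) ^ 2 := pow_lt_pow_left₀ h2 hδ0 two_ne_zero
      rw [mul_pow, div_pow, Real.sq_sqrt zero_le_two] at h3
      have h4 : ((1 - 2 * α) * g) ^ 2 ≤ ((1 - 2 * ε) * g) ^ 2 :=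
        pow_le_pow_left₀ (mul_nonneg (by linarith) hg0.le)
          (mul_le_mul_of_nonneg_right (by linarith) hg0.le) 2
      have h5 := (hz.trans hR).trans_lt h3
      rw [mul_comm _ (s ^ 2)] at h5
      have h6 := lt_of_mul_lt_mul_left h5 (sq_nonneg s)
      linarith
  obtain ⟨D, σ, hD, hDo, hσ, hn2⟩ := exists_blockDiag_mul_perm_near c.index (index_surjective c) γ
    hg0 (fun j k hjk => gap_le γ hjk) hε0 (hεα.trans hα1) hQo hZ hoff hdiag
  refine ⟨hε0, hεα.trans hα1, D, σ.permMatrix ℝ, (isBlockDiag_iff c).mpr hD, hDo,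
    isBlockPreservingPerm_permMatrix c hσ, ?_⟩
  -- Here `W = W' Qᵀ`, so the error equals that of approximating `Qᵀ`.
  have e : W - W' * D * σ.permMatrix ℝ = W' * (Qᵀ - D * σ.permMatrix ℝ) := by
    rw [Matrix.mul_sub, hQ, Matrix.transpose_mul, Matrix.transpose_transpose, ← Matrix.mul_assoc,
      mul_eq_one_comm.mp hW'o, Matrix.one_mul, Matrix.mul_assoc]
  rw [e, frobSq_orthogonal_mul hW'o]
  exact hn2

theorem one_le_frobNorm_orthogonal (hn : 0 < n) {U : Matrix (Fin n) (Fin n) ℝ}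
    (hU : U ∈ Matrix.orthogonalGroup (Fin n) ℝ) : 1 ≤ frobNorm U :=
  (specNorm_orthogonal hn hU).symm.le.trans (specNorm_le_frobNorm U)

theorem sqrt_le_of_sq_mul_le {ε x : ℝ} (h0 : 0 ≤ ε) (h1 : ε < 2 / 5)
    (hx : (1 - ε) ^ 2 * x ≤ 2 * ε ^ 2) : √x ≤ √2 * ε + 3 * ε ^ 2 := by
  have hs : √2 ^ 2 = 2 := Real.sq_sqrt (by norm_num)
  have hs2 : √2 ≤ 3 / 2 := Real.sqrt_le_iff.mpr (by norm_num)
  have hp : 0 < 1 - ε := by linarith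
  have h3 : x ≤ (√2 * ε / (1 - ε)) ^ 2 := by
    rw [div_pow, mul_pow, hs, le_div_iff₀ (by positivity)]
    linarith
  refine (Real.sqrt_le_sqrt h3).trans ?_
  rw [Real.sqrt_sq (by positivity), div_le_iff₀ hp]
  nlinarith [mul_nonneg (sq_nonneg ε) (sub_nonneg.mpr hs2),
    mul_nonneg (sq_nonneg ε) (sub_nonneg.mpr h1.le)]

end Bound

end JBD

end

theorem corollary3p3 (t : ℕ) (ht : 2 ≤ t) :
    -- the constant of the second order term depends on `t` alone
    ∃ C : ℝ, ∀ (m n : ℕ) (c : Composition n) (_ : c.length = t)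
      (A A' : Fin m → Matrix (Fin n) (Fin n) ℝ) (W W' : Matrix (Fin n) (Fin n) ℝ)
      (γ : Fin c.length → ℝ),
      JBD.IsBlockDiagonalizer c A W →
      (∀ j, Module.finrank ℝ (JBD.nullSpace (JBD.diagBlocks c A W j)) = 1) →
      W ∈ Matrix.orthogonalGroup (Fin n) ℝ →
      W' ∈ Matrix.orthogonalGroup (Fin n) ℝ →
      Function.Injective γ →
      (∀ j, |γ j| ≤ 1) →
      JBD.delta c γ A A' W W' = JBD.rTilde c γ A' W' + 2 * JBD.deltaA A A' ∧
      (JBD.IsSmall c γ A A' W W' →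
        ∀ nrm : Matrix (Fin n) (Fin n) ℝ → ℝ, nrm = JBD.specNorm ∨ nrm = JBD.frobNorm →
          ∃ e : ℝ, IsLeast (JBD.relErrors c nrm W W') e ∧
            e ≤ JBD.tauC t / JBD.alphaC t *
                ((√(t : ℝ) + √((t : ℝ) - 1)) * JBD.delta c γ A A' W W' /
                  (JBD.gap γ * JBD.omegaUq c A W))
              + C * (JBD.delta c γ A A' W W' / (JBD.gap γ * JBD.omegaUq c A W)) ^ 2) := by
  -- The constant comes from `√2 ε / (1 - ε) ≤ √2 ε + 3 ε²` for `0 ≤ ε < 2/5`, and does not even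
  -- depend on `t`.
  refine ⟨3, ?_⟩
  intro m n c hct A A' W W' γ hWd hnull hW hW' hγ hγ1
  subst hct
  have hn : 0 < n := c.length_pos_iff.mp (by omega)
  refine ⟨JBD.delta_eq_of_orthogonal hn γ A A' hW hW', fun hsmall nrm hnrm => ?_⟩
  obtain ⟨hε0, hε1, D, P, hD, hDo, hP, hnear⟩ :=
    JBD.exists_near_of_isSmall ht hγ hγ1 hWd.2 hnull hW hW' hsmall rfl
  have hcont : Continuous nrm := by
    rcases hnrm with rfl | rfl
    · exact JBD.continuous_specNorm
    · exact JBD.continuous_frobNorm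
  have hle : ∀ X, nrm X ≤ JBD.frobNorm X := by
    rcases hnrm with rfl | rfl
    · exact JBD.specNorm_le_frobNorm
    · exact fun _ => le_rfl
  -- Dividing by `nrm W' ≥ 1` can only decrease the error, so the absolute Frobenius estimate serves
  -- both norms.
  have hone : 1 ≤ nrm W' := by
    rcases hnrm with rfl | rfl
    · exact (JBD.specNorm_orthogonal hn hW').ge
    · exact JBD.one_le_frobNorm_orthogonal hn hW'
  have hmem : nrm (W - W' * D * P) / nrm W' ∈ JBD.relErrors c nrm W W' :=
    ⟨D, P, hD, hDo, hP, rfl⟩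
  obtain ⟨e, he⟩ := JBD.exists_isLeast_relErrors c hcont W W' ⟨_, hmem⟩
  refine ⟨e, he, (he.2 hmem).trans ?_⟩
  have h1 : nrm (W - W' * D * P) / nrm W' ≤ JBD.frobNorm (W - W' * D * P) :=
    (div_le_div_of_nonneg_right (hle _) (zero_le_one.trans hone)).trans
      (div_le_self (Real.sqrt_nonneg _) hone)
  refine h1.trans ((JBD.sqrt_le_of_sq_mul_le hε0 hε1 hnear).trans ?_)
  rw [mul_div_assoc, ← mul_assoc]
  exact add_le_add_left
    (mul_le_mul_of_nonneg_right (JBD.sqrt_two_le_leading_constant ht) hε0) _
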